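/- Let $\mathcal{P}$ be a convex polygon in the plane, regarded as a closed two-dimensional set, with exactly $n\ge 3$ vertices (its vertices are its corners, i.e. its extreme points). A triangulation $T$ of $\mathcal{P}$ is a maximal crossing-free straight-line graph whose vertices are the vertices of $\mathcal{P}$ and whose edges lie inside $\mathcal{P}$. Its dual graph $T^*$ has a vertex for each bounded face of $T$, and two distinct faces are adjacent if and only if they share an edge of $T$; the dual diameter of $T$ is the diameter of $T^*$. A minimum dual diameter triangulation (minDT) of $\mathcal{P}$ is a triangulation of $\mathcal{P}$ whose dual diameter is smallest among all triangulations of $\mathcal{P}$. Let $m\ge 1$ be an integer with $n\in\{3\cdot 2^{m-1}+1,\dots,3\cdot 2^m\}$. Then every minDT of $\mathcal{P}$ has dual diameter exactly $$2\lceil\log_2(n/3)\rceil-1 \quad\text{if } n\in\{3\cdot 2^{m-1}+1,\dots,4\cdot 2^{m-1}\},$$ and exactly $$2\lceil\log_2(n/3)\rceil \quad\text{if } n\in\{4\cdot 2^{m-1}+1,\dots,3\cdot 2^m\}.$$ -/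

import Mathlib

namespace DualDiameter

/-- The Euclidean plane. -/
abbrev Plane : Type := EuclideanSpace ℝ (Fin 2)

/-- A convex polygon, regarded as a closed two-dimensional subset of the plane: the convex hull
of finitely many points, with nonempty interior. -/
def IsConvexPolygon (P : Set Plane) : Prop :=
  (∃ S : Finset Plane, P = convexHull ℝ (S : Set Plane)) ∧ (interior P).Nonempty

/-- The vertices (corners) of a convex polygon are its extreme points. -/
def vertices (P : Set Plane) : Set Plane := P.extremePoints ℝ

/-- A geometric (straight-line) graph on the point set `V` is crossing-free: no vertex lies on an
edge except as one of its endpoints, and two distinct edges meet at most in common endpoints. -/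
def CrossingFree {V : Set Plane} (G : SimpleGraph V) : Prop :=
  (∀ u v w : V, G.Adj u v → (w : Plane) ∈ segment ℝ (u : Plane) v → w = u ∨ w = v) ∧
  (∀ u v w z : V, G.Adj u v → G.Adj w z → s(u, v) ≠ s(w, z) →
    segment ℝ (u : Plane) v ∩ segment ℝ (w : Plane) z ⊆
      ({(u : Plane), (v : Plane)} : Set Plane) ∩ {(w : Plane), (z : Plane)})

/-- All edges of the geometric graph `G` lie inside `P`. -/
def EdgesInside (P : Set Plane) {V : Set Plane} (G : SimpleGraph V) : Prop :=
  ∀ u v : V, G.Adj u v → segment ℝ (u : Plane) v ⊆ P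

/-- A triangulation of `P`: a maximal crossing-free geometric graph whose vertices are the
vertices of `P` and whose edges lie inside `P`. -/
def IsTriangulation (P : Set Plane) (T : SimpleGraph (vertices P)) : Prop :=
  Maximal (fun G : SimpleGraph (vertices P) => CrossingFree G ∧ EdgesInside P G) T

/-- The points of the plane covered by the vertices and edges of a geometric graph. -/
def drawing {V : Set Plane} (G : SimpleGraph V) : Set Plane :=
  V ∪ {x | ∃ u v : V, G.Adj u v ∧ x ∈ segment ℝ (u : Plane) v}

/-- A bounded face: a bounded connected component of the complement of the drawing. -/
def IsBoundedFace {V : Set Plane} (G : SimpleGraph V) (F : Set Plane) : Prop :=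
  (∃ x ∈ (drawing G)ᶜ, F = connectedComponentIn (drawing G)ᶜ x) ∧ Bornology.IsBounded F

/-- The dual graph: its vertices are the bounded faces, and two distinct faces are adjacent when
some edge of the graph lies on the boundary of both. -/
def dualGraph {V : Set Plane} (G : SimpleGraph V) :
    SimpleGraph {F : Set Plane // IsBoundedFace G F} where
  Adj F F' := F ≠ F' ∧ ∃ u v : V, G.Adj u v ∧
    segment ℝ (u : Plane) v ⊆ closure (F : Set Plane) ∧
    segment ℝ (u : Plane) v ⊆ closure (F' : Set Plane)
  symm := ⟨fun _ _ h => ⟨h.1.symm, by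
    obtain ⟨u, v, huv, h1, h2⟩ := h.2
    exact ⟨u, v, huv, h2, h1⟩⟩⟩
  loopless := ⟨fun _ h => h.1 rfl⟩

/-- The dual diameter: the diameter of the dual graph (it would be `⊤` for a disconnected one). -/
noncomputable def dualDiameter {V : Set Plane} (G : SimpleGraph V) : ℕ∞ :=
  (dualGraph G).ediam

/-- A minimum dual diameter triangulation (minDT) of `P`. -/
def IsMinDT (P : Set Plane) (T : SimpleGraph (vertices P)) : Prop :=
  IsTriangulation P T ∧
    ∀ T' : SimpleGraph (vertices P), IsTriangulation P T' → dualDiameter T ≤ dualDiameter T'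

end DualDiameter

/-! Fix one side of the polygon as root. The triangle on a chord splits off two smaller chords, so a
triangulation is a rooted binary tree whose n - 1 leaves are the other sides and whose nodes are the
triangles. Two triangles share an edge exactly when their nodes are parent and child, so the dual
diameter is the diameter of the tree of nodes, and the problem becomes: how small can this diameter
be for a binary tree with n - 1 leaves?

With diameter at most D a tree has fewer than `capacity D` leaves, where `capacity D` is 3·2^k for D
= 2k and 4·2^k for D = 2k + 1 (`leaves_lt_capacity`), and every smaller positive number of leaves
occurs (`exists_leaves_eq_diam_le`). Hence a minDT has as dual diameter the least D with n ≤
`capacity D`, and the breakpoints of the statement are values of `capacity`.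

The geometry is removed by labelling the vertices counterclockwise (`exists_convexPosition`):
segments cross exactly when their labels interleave (`crossingFree_iff`). Bounded faces are the open
triangles on three pairwise joined vertices (`isBoundedFace_iff`), and `IsTriangleGraph` records the
resulting dual graph. Its diameter is that of the tree (`ediam_eq`): paths through root triangles
bound distances from above, 1-Lipschitz functions from below. -/

/-! ### Binary trees: number of leaves against diameter -/

/-- Rooted binary trees. Their leaves are the sides of a polygon other than the root side, their
nodes the triangles of a triangulation. -/
inductive BinTree : Type
  | leaf : BinTree
  | node : BinTree → BinTree → BinTree

namespace BinTree

/-- The number of leaves. -/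
def leaves : BinTree → ℕ
  | leaf => 1
  | node l r => l.leaves + r.leaves

/-- The number of levels of nodes. -/
def height : BinTree → ℕ
  | leaf => 0
  | node l r => max l.height r.height + 1

/-- The diameter of the tree formed by the nodes. -/
def diam : BinTree → ℕ
  | leaf => 0
  | node l r => max (max l.diam r.diam) (l.height + r.height)

/-- The chords of the triangulation described by a tree on the vertices
`a, a + 1, …, a + t.leaves`. -/
def edges : BinTree → ℕ → ℕ → ℕ → Prop
  | leaf, a, x, y => x = a ∧ y = a + 1
  | node l r, a, x, y =>
    (x = a ∧ y = a + (l.leaves + r.leaves)) ∨ l.edges a x y ∨ r.edges (a + l.leaves) x y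

theorem leaves_pos (t : BinTree) : 0 < t.leaves := by
  induction t with
  | leaf => simp [leaves]
  | node l r hl hr => simp [leaves]; omega

theorem edges_bounds (t : BinTree) {a x y : ℕ} (h : t.edges a x y) :
    a ≤ x ∧ x < y ∧ y ≤ a + t.leaves := by
  induction t generalizing a with
  | leaf => simp only [edges] at h; simp only [leaves]; omega
  | node l r hl hr =>
    have h1 := l.leaves_pos
    have h2 := r.leaves_pos
    simp only [leaves]
    rcases h with h | h | h
    · omega
    · have := hl h; omega
    · have := hr h; omega

theorem edges_root (t : BinTree) (a : ℕ) : t.edges a a (a + t.leaves) := by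
  cases t <;> simp [edges, leaves]

theorem edges_noncrossing (t : BinTree) {a i j k l : ℕ} (hij : i < j) (hjk : j < k) (hkl : k < l)
    (h1 : t.edges a i k) (h2 : t.edges a j l) : False := by
  induction t generalizing a with
  | leaf => simp only [edges] at h1 h2; omega
  | node s r hs hr =>
    have b1 := edges_bounds _ h1
    have b2 := edges_bounds _ h2
    simp only [leaves] at b1 b2
    rcases h1 with h1 | h1 | h1 <;> rcases h2 with h2 | h2 | h2
    · omega
    · omega
    · omega
    · omega
    · exact hs h1 h2
    · have := edges_bounds _ h1; have := edges_bounds _ h2; omega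
    · omega
    · have := edges_bounds _ h1; have := edges_bounds _ h2; omega
    · exact hr h1 h2

/-- One more than the largest number of leaves of a tree of diameter at most `D`. -/
def capacity (D : ℕ) : ℕ := 2 * 2 ^ (D / 2) + 2 ^ (D - D / 2)

theorem capacity_mono {a b : ℕ} (h : a ≤ b) : capacity a ≤ capacity b := by
  have h1 : 2 ^ (a / 2) ≤ 2 ^ (b / 2) := Nat.pow_le_pow_right (by norm_num) (by omega)
  have h2 : 2 ^ (a - a / 2) ≤ 2 ^ (b - b / 2) := Nat.pow_le_pow_right (by norm_num) (by omega)
  simp only [capacity]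
  omega

/-- Here a and b are the heights of the taller and the shorter subtree, x and y their leaves. Since
a + b ≤ D, the shorter one has at most 2^(D - a) leaves. This is half of the reserve 2^(D + 1 - a)
kept by the taller one, and the other half is the reserve of the new tree. At a = D / 2 both
subtrees are bounded by full trees, which gives the value of `capacity`. -/
theorem capacity_step {D a b x y : ℕ} (hba : b ≤ a) (hab : a + b ≤ D) (hx : x ≤ 2 ^ a)
    (hy : y ≤ 2 ^ b) (hxD : D / 2 + 1 ≤ a → x + 2 ^ (D + 1 - a) ≤ capacity D)
    (ha : D / 2 ≤ a) : x + y + 2 ^ (D - a) ≤ capacity D := by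
  rcases ha.eq_or_lt with ha | ha
  · have : 2 ^ b ≤ 2 ^ (D / 2) := Nat.pow_le_pow_right (by norm_num) (by omega)
    rw [← ha] at hx ⊢
    simp only [capacity]
    omega
  · have h1 := hxD ha
    have h2 : 2 ^ b ≤ 2 ^ (D - a) := Nat.pow_le_pow_right (by norm_num) (by omega)
    have h3 : 2 ^ (D + 1 - a) = 2 * 2 ^ (D - a) := by
      rw [show D + 1 - a = (D - a) + 1 by omega, pow_succ, mul_comm]
    omega

theorem leaves_le_two_pow_height (t : BinTree) : t.leaves ≤ 2 ^ t.height := by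
  induction t with
  | leaf => simp [leaves, height]
  | node l r hl hr =>
    have h1 : 2 ^ l.height ≤ 2 ^ max l.height r.height :=
      Nat.pow_le_pow_right (by norm_num) (le_max_left _ _)
    have h2 : 2 ^ r.height ≤ 2 ^ max l.height r.height :=
      Nat.pow_le_pow_right (by norm_num) (le_max_right _ _)
    simp only [leaves, height, pow_succ]
    omega

/-- The induction needs the summand 2^(D + 1 - height): it is the room left for the siblings that
can still be attached above the tree without exceeding diameter D. -/
theorem leaves_add_le_capacity (t : BinTree) {D : ℕ} (hD : t.diam ≤ D)
    (hh : D / 2 + 1 ≤ t.height) : t.leaves + 2 ^ (D + 1 - t.height) ≤ capacity D := by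
  induction t with
  | leaf => simp [height] at hh
  | node l r hl hr =>
    simp only [diam, max_le_iff] at hD
    simp only [height] at hh ⊢
    simp only [leaves]
    rcases le_total r.height l.height with h | h
    · rw [max_eq_left h] at hh ⊢
      rw [Nat.add_sub_add_right]
      exact capacity_step h hD.2 l.leaves_le_two_pow_height r.leaves_le_two_pow_height
        (hl hD.1.1) (by omega)
    · rw [max_eq_right h] at hh ⊢
      rw [Nat.add_sub_add_right, add_comm l.leaves]
      exact capacity_step h (by omega) r.leaves_le_two_pow_height l.leaves_le_two_pow_height
        (hr hD.1.2) (by omega)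

theorem leaves_lt_capacity (t : BinTree) {D : ℕ} (hD : t.diam ≤ D) :
    t.leaves < capacity D := by
  by_cases hh : D / 2 + 1 ≤ t.height
  · have := t.leaves_add_le_capacity hD hh
    have : 0 < 2 ^ (D + 1 - t.height) := by positivity
    omega
  · have h1 := t.leaves_le_two_pow_height
    have h2 : 2 ^ t.height ≤ 2 ^ (D / 2) := Nat.pow_le_pow_right (by norm_num) (by omega)
    have : 0 < 2 ^ (D / 2) := by positivity
    have : 0 < 2 ^ (D - D / 2) := by positivity
    simp only [capacity]
    omega

theorem diam_le (t : BinTree) : t.diam ≤ 2 * (t.height - 1) := by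
  induction t with
  | leaf => simp [diam]
  | node l r hl hr => simp only [diam, height]; omega

theorem exists_leaves_eq_height_le (h : ℕ) {L : ℕ} (hL : 0 < L) (hLh : L ≤ 2 ^ h) :
    ∃ t : BinTree, t.leaves = L ∧ t.height ≤ h := by
  induction h generalizing L with
  | zero => exact ⟨leaf, by simp [leaves] at hLh ⊢; omega, by simp [height]⟩
  | succ h ih =>
    rcases Nat.lt_or_ge L 2 with h1 | h1
    · exact ⟨leaf, by simp [leaves]; omega, by simp [height]⟩
    · rw [pow_succ] at hLh
      obtain ⟨l, hl, hl'⟩ := ih (L := L / 2) (by omega) (by omega)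
      obtain ⟨r, hr, hr'⟩ := ih (L := L - L / 2) (by omega) (by omega)
      exact ⟨node l r, by simp only [leaves]; omega, by simp only [height]; omega⟩

/-- The extremal trees of `leaves_add_le_capacity`, built upwards: a balanced tree of height D / 2 +
1 at j = 0, then in each step one more root with a lower balanced tree on its other side. -/
theorem exists_leaves_eq_diam_le_of_height {D L : ℕ} (hL : 0 < L) (j : ℕ) (hj : D / 2 + j ≤ D)
    (h : L + 2 ^ (D - (D / 2 + j)) ≤ capacity D) :
    ∃ t : BinTree, t.leaves = L ∧ t.height ≤ D / 2 + 1 + j ∧ t.diam ≤ D := by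
  induction j generalizing L with
  | zero =>
    simp only [capacity, add_zero] at h
    obtain ⟨t, h1, h2⟩ := exists_leaves_eq_height_le (D / 2 + 1) hL (by rw [pow_succ]; omega)
    have := t.diam_le
    exact ⟨t, h1, by omega, by omega⟩
  | succ j ih =>
    have e : 2 ^ (D - (D / 2 + j)) = 2 * 2 ^ (D - (D / 2 + (j + 1))) := by
      rw [show D - (D / 2 + j) = (D - (D / 2 + (j + 1))) + 1 by omega, pow_succ, mul_comm]
    by_cases hc : L + 2 ^ (D - (D / 2 + j)) ≤ capacity D
    · obtain ⟨t, h1, h2, h3⟩ := ih hL (by omega) hc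
      exact ⟨t, h1, by omega, h3⟩
    · have hp : 2 ^ (D - (D / 2 + j)) ≤ 2 ^ (D - D / 2) :=
        Nat.pow_le_pow_right (by norm_num) (by omega)
      have hq : 0 < 2 ^ (D / 2) := by positivity
      have hcap : 2 ^ (D - (D / 2 + j)) < capacity D := by simp only [capacity]; omega
      -- The left subtree is the largest that stage j allows. The right one takes the remaining
      -- leaves, and its height makes the two height bounds add up to exactly D.
      obtain ⟨l, l1, l2, l3⟩ := ih (L := capacity D - 2 ^ (D - (D / 2 + j)))
        (by omega) (by omega) (by omega)
      obtain ⟨r, r1, r2⟩ := exists_leaves_eq_height_le (D - (D / 2 + (j + 1)))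
        (L := L - l.leaves) (by omega) (by omega)
      have := r.diam_le
      exact ⟨node l r, by simp only [leaves]; omega, by simp only [height]; omega,
        by simp only [diam]; omega⟩

theorem exists_leaves_eq_diam_le {D L : ℕ} (hL : 0 < L) (h : L < capacity D) :
    ∃ t : BinTree, t.leaves = L ∧ t.diam ≤ D := by
  obtain ⟨t, h1, -, h3⟩ := exists_leaves_eq_diam_le_of_height (D := D) hL (D - D / 2) (by omega)
    (by rw [show D - (D / 2 + (D - D / 2)) = 0 by omega]; simpa using h)
  exact ⟨t, h1, h3⟩

end BinTree

/-! ### From maximal non-crossing chords to a tree -/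

/-- No two chords of the relation `E` interleave. -/
def NonCrossing (E : ℕ → ℕ → Prop) : Prop :=
  ∀ i j k l, i < j → j < k → k < l → E i k → E j l → False

theorem NonCrossing.exists_tree {E : ℕ → ℕ → Prop} {n : ℕ} (hE : NonCrossing E)
    (hmax : ∀ i j, i < j → j < n → (∀ k l, E k l → k < l →
      ¬ (k < i ∧ i < l ∧ l < j) ∧ ¬ (i < k ∧ k < j ∧ j < l)) → E i j)
    {a b : ℕ} (hab : a < b) (hb : b < n) (h : E a b) :
    ∃ t : BinTree, a + t.leaves = b ∧ ∀ x y, t.edges a x y → E x y := by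
  induction hm : b - a using Nat.strong_induction_on generalizing a b with
  | _ m ih =>
    rcases Nat.lt_or_ge (a + 1) b with hlt | hge
    · classical
      have h0 : E a (a + 1) := hmax _ _ (by omega) (by omega) fun k l _ _ => by omega
      -- The apex of the triangle on the chord a b is the last neighbour c of a before b. A chord
      -- crossing c b would cross a b or a c, or would join a to a point between c and b; so c b is
      -- a chord by maximality.
      let c := Nat.findGreatest (fun c => E a c) (b - 1)
      have hc : E a c := Nat.findGreatest_spec (P := fun c => E a c) (m := a + 1) (by omega) h0
      have hac : a + 1 ≤ c := Nat.le_findGreatest (by omega) h0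
      have hcb : c ≤ b - 1 := Nat.findGreatest_le _
      have hcmax : ∀ d, c < d → d ≤ b - 1 → ¬ E a d := fun d h1 h2 =>
        Nat.findGreatest_is_greatest h1 h2
      have hcb' : E c b := by
        refine hmax _ _ (by omega) hb fun k l hkl hlt => ⟨?_, ?_⟩
        · rintro ⟨h1, h2, h3⟩
          rcases lt_trichotomy k a with h4 | h4 | h4
          · exact hE k a l b h4 (by omega) h3 hkl h
          · subst h4; exact hcmax l h2 (by omega) hkl
          · exact hE a k c l h4 h1 h2 hc hkl
        · rintro ⟨h1, h2, h3⟩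
          exact hE a k b l (by omega) h2 h3 h hkl
      obtain ⟨s, hs, hs'⟩ := ih _ (by omega) (by omega) (by omega) hc rfl
      obtain ⟨r, hr, hr'⟩ := ih _ (by omega) (by omega) (by omega) hcb' rfl
      refine ⟨.node s r, by simp only [BinTree.leaves]; omega, ?_⟩
      rintro x y (⟨rfl, rfl⟩ | hxy | hxy)
      · convert h using 1; omega
      · exact hs' _ _ hxy
      · rw [hs] at hxy; exact hr' _ _ hxy
    · obtain rfl : b = a + 1 := by omega
      exact ⟨.leaf, rfl, by rintro x y ⟨rfl, rfl⟩; exact h⟩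

/-! ### The diameter of the graph of triangles -/

/-- A graph `H` whose vertices are, through `τ`, the triples of elements of `{0, …, n - 1}` that
are pairwise related by `E`, adjacent when they have two elements in common. -/
structure IsTriangleGraph (n : ℕ) (E : ℕ → ℕ → Prop) {X : Type*} (H : SimpleGraph X)
    (τ : X → Finset ℕ) : Prop where
  injective : Function.Injective τ
  eq_triple : ∀ x, ∃ i j k, i < j ∧ j < k ∧ k < n ∧ E i j ∧ E j k ∧ E i k ∧ τ x = {i, j, k}
  exists_eq : ∀ i j k, i < j → j < k → k < n → E i j → E j k → E i k → ∃ x, τ x = {i, j, k}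
  adj_iff : ∀ x y, H.Adj x y ↔ x ≠ y ∧ ∃ u v, u < v ∧ u ∈ τ x ∧ v ∈ τ x ∧ u ∈ τ y ∧ v ∈ τ y

/-- Lower bounds for distances come from exhibiting such a 1-Lipschitz f; no shortest path has to be
analysed. -/
theorem SimpleGraph.Walk.le_add_length {X : Type*} {H : SimpleGraph X} {f : X → ℤ}
    (hf : ∀ x y, H.Adj x y → f x ≤ f y + 1) {x y : X} (w : H.Walk x y) :
    f x ≤ f y + w.length := by
  induction w with
  | nil => simp
  | cons h w ih => have := hf _ _ h; simp only [Walk.length_cons]; push_cast; omega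

theorem SimpleGraph.le_add_of_edist_le {X : Type*} {H : SimpleGraph X} {f : X → ℤ}
    (hf : ∀ x y, H.Adj x y → f x ≤ f y + 1) {x y : X} {D : ℕ} (h : H.edist x y ≤ D) :
    f x ≤ f y + D := by
  obtain ⟨w, hw⟩ := H.exists_walk_of_edist_ne_top
    (ne_top_of_le_ne_top (ENat.natCast_ne_top D) h)
  have := w.le_add_length hf
  rw [← hw] at h
  have : w.length ≤ D := by exact_mod_cast h
  omega

namespace IsTriangleGraph

open BinTree

variable {n : ℕ} {E : ℕ → ℕ → Prop} {X : Type*} {H : SimpleGraph X} {τ : X → Finset ℕ}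

theorem rel (hX : IsTriangleGraph n E H τ) {x : X} {u v : ℕ} (hu : u ∈ τ x) (hv : v ∈ τ x)
    (huv : u < v) : E u v := by
  obtain ⟨i, j, k, hij, hjk, -, h1, h2, h3, h⟩ := hX.eq_triple x
  simp only [h, Finset.mem_insert, Finset.mem_singleton] at hu hv
  rcases hu with rfl | rfl | rfl <;> rcases hv with rfl | rfl | rfl <;>
    first | assumption | omega

/-- If c lies strictly between the extreme labels of a triangle, then its middle label is c, since
otherwise a side crosses a c or c b. Its long side then has to end at a and b for the same reason.
-/
theorem subset_or_subset_or_eq (hX : IsTriangleGraph n E H τ) (hE : NonCrossing E) {a c b : ℕ}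
    (h1 : E a c) (h2 : E c b) {x : X}
    (hx : τ x ⊆ Finset.Icc a b) :
    τ x ⊆ Finset.Icc a c ∨ τ x ⊆ Finset.Icc c b ∨ τ x = {a, c, b} := by
  obtain ⟨i, j, k, hij, hjk, -, h3, h4, h5, h⟩ := hX.eq_triple x
  simp only [h, Finset.insert_subset_iff, Finset.singleton_subset_iff, Finset.mem_Icc] at hx ⊢
  have c1 := hE a j c k
  have c2 := hE a i c k
  have c3 := hE i c j b
  have c4 := hE i c k b
  by_cases hkc : k ≤ c
  · left; omega
  by_cases hic : c ≤ i
  · right; left; omega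
  right; right
  have hj : j = c := by
    rcases lt_trichotomy j c with h6 | h6 | h6
    · exact (c1 (by omega) h6 (by omega) h1 h4).elim
    · exact h6
    · exact (c3 (by omega) h6 (by omega) h3 h2).elim
  have hi : i = a := by
    by_contra h6
    exact c2 (by omega) (by omega) (by omega) h1 h5
  have hk : k = b := by
    by_contra h6
    exact c4 (by omega) (by omega) (by omega) h5 h2
  rw [hi, hj, hk]

/-- The chord a b separates: y has a label outside [a, b], so a label of y strictly inside would
give a side crossing a b. The two shared labels can only be a and b. -/
theorem endpoints_mem (hX : IsTriangleGraph n E H τ) (hE : NonCrossing E) {a b : ℕ}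
    (hab : E a b) {x y : X} (hxy : H.Adj x y) (hx : τ x ⊆ Finset.Icc a b)
    (hy : ¬ τ y ⊆ Finset.Icc a b) : a ∈ τ x ∧ b ∈ τ x := by
  obtain ⟨-, u, v, huv, hux, hvx, huy, hvy⟩ := (hX.adj_iff x y).1 hxy
  obtain ⟨w, hw, hwab⟩ := Finset.not_subset.1 hy
  have hu := Finset.mem_Icc.1 (hx hux)
  have hv := Finset.mem_Icc.1 (hx hvx)
  rw [Finset.mem_Icc] at hwab
  suffices ∀ z ∈ τ y, a < z → z < b → False by
    have h1 : u = a := by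
      by_contra h; exact this u huy (by omega) (by omega)
    have h2 : v = b := by
      by_contra h; exact this v hvy (by omega) (by omega)
    exact ⟨h1 ▸ hux, h2 ▸ hvx⟩
  intro z hz haz hzb
  rcases Nat.lt_or_ge w a with h | h
  · exact hE w a z b h haz hzb (hX.rel hw hz (by omega)) hab
  · exact hE a z b w haz hzb (by omega) hab (hX.rel hz hw (by omega))

theorem not_subset_Icc_succ (hX : IsTriangleGraph n E H τ) (x : X) (a : ℕ) :
    ¬ τ x ⊆ Finset.Icc a (a + 1) := by
  obtain ⟨i, j, k, hij, hjk, -, -, -, -, h⟩ := hX.eq_triple x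
  simp only [h, Finset.insert_subset_iff, Finset.singleton_subset_iff, Finset.mem_Icc]
  omega

theorem edges_node {l r : BinTree} {a : ℕ} (ht : ∀ x y, (node l r).edges a x y → E x y) :
    (∀ x y, l.edges a x y → E x y) ∧ (∀ x y, r.edges (a + l.leaves) x y → E x y) ∧
      E a (a + l.leaves) ∧ E (a + l.leaves) (a + l.leaves + r.leaves) ∧
      E a (a + l.leaves + r.leaves) :=
  ⟨fun x y h => ht x y (.inr (.inl h)), fun x y h => ht x y (.inr (.inr h)),
    ht _ _ (.inr (.inl (l.edges_root a))), ht _ _ (.inr (.inr (r.edges_root _))),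
    ht _ _ (.inl ⟨rfl, add_assoc _ _ _⟩)⟩

/-- Here z is the triangle across the root chord of `t`. It is adjacent to the root triangle of `t`,
which in turn lies across the root chords of both subtrees. -/
theorem edist_le_height (hX : IsTriangleGraph n E H τ) (hE : NonCrossing E) (t : BinTree) {a : ℕ}
    (hn : a + t.leaves < n) (ht : ∀ x y, t.edges a x y → E x y) {x z : X}
    (hx : τ x ⊆ Finset.Icc a (a + t.leaves)) (hz : ¬ τ z ⊆ Finset.Icc a (a + t.leaves))
    (ha : a ∈ τ z) (hb : a + t.leaves ∈ τ z) : H.edist z x ≤ t.height := by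
  induction t generalizing a x z with
  | leaf => exact (hX.not_subset_Icc_succ x a hx).elim
  | node l r hl hr =>
    obtain ⟨t1, t2, e1, e2, e3⟩ := edges_node ht
    have l1 := l.leaves_pos
    have r1 := r.leaves_pos
    simp only [leaves, ← add_assoc] at hn hx hz hb
    obtain ⟨y, hy⟩ := hX.exists_eq a (a + l.leaves) (a + l.leaves + r.leaves) (by omega)
      (by omega) hn e1 e2 e3
    have hzy : H.Adj z y := by
      rw [hX.adj_iff]
      refine ⟨?_, a, a + l.leaves + r.leaves, by omega, ha, hb, by simp [hy], by simp [hy]⟩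
      rintro rfl
      apply hz
      simp only [hy, Finset.insert_subset_iff, Finset.singleton_subset_iff, Finset.mem_Icc]
      omega
    have hzx := H.edist_triangle (u := z) (v := y) (w := x)
    rw [SimpleGraph.edist_eq_one_iff_adj.2 hzy] at hzx
    refine hzx.trans ?_
    simp only [height]
    rw [add_comm, Nat.cast_add, Nat.cast_one]
    gcongr
    rcases hX.subset_or_subset_or_eq hE e1 e2 hx with h | h | h
    · refine (hl (by omega) t1 h ?_ (by simp [hy]) (by simp [hy])).trans
        (by exact_mod_cast le_max_left _ _)
      simp only [hy, Finset.insert_subset_iff, Finset.singleton_subset_iff, Finset.mem_Icc]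
      omega
    · refine (hr (by omega) t2 h ?_ (by simp [hy]) (by simp [hy])).trans
        (by exact_mod_cast le_max_right _ _)
      simp only [hy, Finset.insert_subset_iff, Finset.singleton_subset_iff, Finset.mem_Icc]
      omega
    · rw [hX.injective (h.trans hy.symm)]; simp

theorem edist_le_diam (hX : IsTriangleGraph n E H τ) (hE : NonCrossing E) (t : BinTree) {a : ℕ}
    (hn : a + t.leaves < n) (ht : ∀ x y, t.edges a x y → E x y) {x y : X}
    (hx : τ x ⊆ Finset.Icc a (a + t.leaves)) (hy : τ y ⊆ Finset.Icc a (a + t.leaves)) :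
    H.edist x y ≤ t.diam := by
  induction t generalizing a x y with
  | leaf => exact (hX.not_subset_Icc_succ x a hx).elim
  | node l r hl hr =>
    obtain ⟨t1, t2, e1, e2, e3⟩ := edges_node ht
    have l1 := l.leaves_pos
    have r1 := r.leaves_pos
    simp only [leaves, ← add_assoc] at hn hx hy
    obtain ⟨z, hz⟩ := hX.exists_eq a (a + l.leaves) (a + l.leaves + r.leaves) (by omega)
      (by omega) hn e1 e2 e3
    have zl : ¬ τ z ⊆ Finset.Icc a (a + l.leaves) := by
      simp only [hz, Finset.insert_subset_iff, Finset.singleton_subset_iff, Finset.mem_Icc]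
      omega
    have zr : ¬ τ z ⊆ Finset.Icc (a + l.leaves) (a + l.leaves + r.leaves) := by
      simp only [hz, Finset.insert_subset_iff, Finset.singleton_subset_iff, Finset.mem_Icc]
      omega
    have dl : ∀ x, τ x ⊆ Finset.Icc a (a + l.leaves) → H.edist z x ≤ l.height := fun x h =>
      hX.edist_le_height hE l (by omega) t1 h zl (by simp [hz]) (by simp [hz])
    have dr : ∀ x, τ x ⊆ Finset.Icc (a + l.leaves) (a + l.leaves + r.leaves) →
        H.edist z x ≤ r.height := fun x h =>
      hX.edist_le_height hE r (by omega) t2 h zr (by simp [hz]) (by simp [hz])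
    have hxy := H.edist_triangle (u := x) (v := z) (w := y)
    rw [H.edist_comm (u := x) (v := z)] at hxy
    have m1 : l.diam ≤ (node l r).diam := by simp [diam]
    have m2 : r.diam ≤ (node l r).diam := by simp [diam]
    have m3 : l.height + r.height ≤ (node l r).diam := by simp [diam]
    have m3' : ((l.height + r.height : ℕ) : ℕ∞) ≤ (node l r).diam := by exact_mod_cast m3
    have m4 : ((l.height : ℕ) : ℕ∞) ≤ (node l r).diam := by exact_mod_cast (by omega)
    have m5 : ((r.height : ℕ) : ℕ∞) ≤ (node l r).diam := by exact_mod_cast (by omega)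
    push_cast at m3'
    rcases hX.subset_or_subset_or_eq hE e1 e2 hx with h | h | h <;>
    rcases hX.subset_or_subset_or_eq hE e1 e2 hy with h' | h' | h'
    · exact (hl (by omega) t1 h h').trans (by exact_mod_cast m1)
    · exact hxy.trans ((add_le_add (dl _ h) (dr _ h')).trans m3')
    · rw [hX.injective (h'.trans hz.symm), H.edist_comm]
      exact (dl _ h).trans m4
    · rw [add_comm (l.height : ℕ∞)] at m3'
      exact hxy.trans ((add_le_add (dr _ h) (dl _ h')).trans m3')
    · exact (hr (by omega) t2 h h').trans (by exact_mod_cast m2)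
    · rw [hX.injective (h'.trans hz.symm), H.edist_comm]
      exact (dr _ h).trans m5
    · rw [hX.injective (h.trans hz.symm)]
      exact (dl _ h').trans m4
    · rw [hX.injective (h.trans hz.symm)]
      exact (dr _ h').trans m5
    · rw [hX.injective (h.trans h'.symm)]; simp

/-- A function that vanishes outside the part of the triangulation described by `t`, changes by at
most one between adjacent triangles, and reaches the height of `t`. -/
theorem exists_lipschitz (hX : IsTriangleGraph n E H τ) (hE : NonCrossing E) [Nonempty X]
    (t : BinTree) {a : ℕ} (hn : a + t.leaves < n) (ht : ∀ x y, t.edges a x y → E x y) :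
    ∃ f : X → ℤ, (∀ x, 0 ≤ f x) ∧ (∀ x, ¬ τ x ⊆ Finset.Icc a (a + t.leaves) → f x = 0) ∧
      (∃ x, f x = t.height) ∧ ∀ x y, H.Adj x y → f x ≤ f y + 1 := by
  classical
  induction t generalizing a with
  | leaf =>
    exact ⟨fun _ => 0, by simp, by simp, ⟨Classical.arbitrary X, by simp [height]⟩, by simp⟩
  | node l r hl hr =>
    obtain ⟨t1, t2, e1, e2, e3⟩ := edges_node ht
    have l1 := l.leaves_pos
    have r1 := r.leaves_pos
    simp only [leaves, ← add_assoc] at hn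
    obtain ⟨z, hz⟩ := hX.exists_eq a (a + l.leaves) (a + l.leaves + r.leaves) (by omega)
      (by omega) hn e1 e2 e3
    have zl : ¬ τ z ⊆ Finset.Icc a (a + l.leaves) := by
      simp only [hz, Finset.insert_subset_iff, Finset.singleton_subset_iff, Finset.mem_Icc]
      omega
    have zr : ¬ τ z ⊆ Finset.Icc (a + l.leaves) (a + l.leaves + r.leaves) := by
      simp only [hz, Finset.insert_subset_iff, Finset.singleton_subset_iff, Finset.mem_Icc]
      omega
    have zlr : τ z ⊆ Finset.Icc a (a + l.leaves + r.leaves) := by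
      simp only [hz, Finset.insert_subset_iff, Finset.singleton_subset_iff, Finset.mem_Icc]
      omega
    -- The function of the taller subtree vanishes at the root triangle z; raising it by one on the
    -- whole part of `t` gives the extra level.
    suffices key : ∀ (f : X → ℤ) (m : ℕ), (∀ x, 0 ≤ f x) → f z = 0 →
        (∀ x, ¬ τ x ⊆ Finset.Icc a (a + l.leaves + r.leaves) → f x = 0) →
        (∃ x, f x = m) → (∀ x y, H.Adj x y → f x ≤ f y + 1) →
        ∃ f : X → ℤ, (∀ x, 0 ≤ f x) ∧
          (∀ x, ¬ τ x ⊆ Finset.Icc a (a + l.leaves + r.leaves) → f x = 0) ∧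
          (∃ x, f x = m + 1) ∧ ∀ x y, H.Adj x y → f x ≤ f y + 1 by
      simp only [leaves, ← add_assoc, height]
      rcases le_total r.height l.height with h | h
      · obtain ⟨f, f0, f1, f2, f3⟩ := hl (by omega) t1
        rw [max_eq_left h]; push_cast
        exact key f _ f0 (f1 z zl) (fun x hx => f1 x fun hx' => hx
          (hx'.trans (Finset.Icc_subset_Icc_right (by omega)))) f2 f3
      · obtain ⟨f, f0, f1, f2, f3⟩ := hr (by omega) t2
        rw [max_eq_right h]; push_cast
        exact key f _ f0 (f1 z zr) (fun x hx => f1 x fun hx' => hx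
          (hx'.trans (Finset.Icc_subset_Icc_left (by omega)))) f2 f3
    intro f m f0 fz f1 ⟨x, fx⟩ f3
    refine ⟨fun y => if τ y ⊆ Finset.Icc a (a + l.leaves + r.leaves) then f y + 1 else 0,
      fun y => ?_, fun y hy => if_neg hy, ?_, fun y y' hy => ?_⟩
    · have := f0 y
      dsimp only; split_ifs <;> omega
    · by_cases hx : τ x ⊆ Finset.Icc a (a + l.leaves + r.leaves)
      · exact ⟨x, by simp [hx, fx]⟩
      -- A maximum attained outside the part forces m = 0, and then z has the required value 1.
      · exact ⟨z, by have := f1 x hx; simp [zlr]; omega⟩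
    · have h1 := f3 _ _ hy
      have h2 := f0 y'
      dsimp only
      split_ifs with h3 h4 h4
      · omega
      -- The only drop to 0 occurs on leaving the part, and this happens only from z, where the
      -- raised value is 1.
      · obtain ⟨p, q⟩ := hX.endpoints_mem hE e3 hy h3 h4
        suffices y = z by rw [this, fz]
        rcases hX.subset_or_subset_or_eq hE e1 e2 h3 with h | h | h
        · have := Finset.mem_Icc.1 (h q); omega
        · have := Finset.mem_Icc.1 (h p); omega
        · exact hX.injective (h.trans hz.symm)
      · omega
      · omega

/-- With f and g the functions of the two subtrees, f - g is again 1-Lipschitz, because no triangle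
of one part is adjacent to one of the other. It runs from -`r.height` to `l.height`, which forces
two triangles at least `l.height + r.height` apart. -/
theorem diam_le (hX : IsTriangleGraph n E H τ) (hE : NonCrossing E) [Nonempty X]
    (t : BinTree) {a D : ℕ} (hn : a + t.leaves < n) (ht : ∀ x y, t.edges a x y → E x y)
    (hD : ∀ x y, H.edist x y ≤ D) : t.diam ≤ D := by
  induction t generalizing a with
  | leaf => simp [diam]
  | node l r hl hr =>
    obtain ⟨t1, t2, e1, e2, e3⟩ := edges_node ht
    have l1 := l.leaves_pos
    have r1 := r.leaves_pos
    simp only [leaves, ← add_assoc] at hn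
    obtain ⟨z, hz⟩ := hX.exists_eq a (a + l.leaves) (a + l.leaves + r.leaves) (by omega)
      (by omega) hn e1 e2 e3
    simp only [diam, max_le_iff]
    refine ⟨⟨hl (by omega) t1, hr (by omega) t2⟩, ?_⟩
    obtain ⟨f, f0, f1, ⟨x, fx⟩, f3⟩ := hX.exists_lipschitz hE l (by omega) t1
    obtain ⟨g, g0, g1, ⟨y, gy⟩, g3⟩ := hX.exists_lipschitz hE r (by omega) t2
    have disj : ∀ u v, H.Adj u v → τ u ⊆ Finset.Icc a (a + l.leaves) →
        ¬ τ v ⊆ Finset.Icc (a + l.leaves) (a + l.leaves + r.leaves) := by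
      intro u v huv hu hv
      obtain ⟨-, i, j, hij, hiu, hju, hiv, hjv⟩ := (hX.adj_iff u v).1 huv
      have := Finset.mem_Icc.1 (hu hju)
      have := Finset.mem_Icc.1 (hv hiv)
      omega
    have excl : ∀ u, τ u ⊆ Finset.Icc a (a + l.leaves) →
        ¬ τ u ⊆ Finset.Icc (a + l.leaves) (a + l.leaves + r.leaves) := by
      intro u hu hv
      obtain ⟨i, j, k, hij, hjk, -, -, -, -, h⟩ := hX.eq_triple u
      have := Finset.mem_Icc.1 (hu (show j ∈ τ u by simp [h]))
      have := Finset.mem_Icc.1 (hv (show i ∈ τ u by simp [h]))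
      omega
    have hlip : ∀ u v, H.Adj u v → f u - g u ≤ f v - g v + 1 := by
      intro u v huv
      have a1 := f3 _ _ huv
      have a2 := g3 _ _ huv.symm
      have a3 := f0 v
      have a4 := g0 u
      by_cases hu : τ u ⊆ Finset.Icc a (a + l.leaves)
      · have a5 := g1 v (disj u v huv hu)
        omega
      · have a6 := f1 u hu
        by_cases hv : τ v ⊆ Finset.Icc (a + l.leaves) (a + l.leaves + r.leaves)
        · omega
        · have := g1 v hv
          omega
    have hzl : f z = 0 := f1 z (by
      simp only [hz, Finset.insert_subset_iff, Finset.singleton_subset_iff, Finset.mem_Icc]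
      omega)
    have hzr : g z = 0 := g1 z (by
      simp only [hz, Finset.insert_subset_iff, Finset.singleton_subset_iff, Finset.mem_Icc]
      omega)
    -- If the maximum of f is attained outside its part, the height is 0 and z can be used instead.
    obtain ⟨x', fx', gx'⟩ : ∃ x, f x = l.height ∧ g x = 0 := by
      by_cases hx : τ x ⊆ Finset.Icc a (a + l.leaves)
      · exact ⟨x, fx, g1 x (excl x hx)⟩
      · exact ⟨z, by rw [hzl, ← fx, f1 x hx], hzr⟩
    obtain ⟨y', gy', fy'⟩ : ∃ x, g x = r.height ∧ f x = 0 := by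
      by_cases hy : τ y ⊆ Finset.Icc (a + l.leaves) (a + l.leaves + r.leaves)
      · exact ⟨y, gy, f1 y fun h => excl y h hy⟩
      · exact ⟨z, by rw [hzr, ← gy, g1 y hy], hzl⟩
    have := SimpleGraph.le_add_of_edist_le hlip (hD x' y')
    omega

theorem ediam_eq (hX : IsTriangleGraph n E H τ) (hE : NonCrossing E) (t : BinTree)
    (hn : t.leaves + 1 = n) (hn3 : 3 ≤ n) (ht : ∀ x y, t.edges 0 x y → E x y) :
    H.ediam = t.diam := by
  have hne : Nonempty X := by
    cases t with
    | leaf => simp [leaves] at hn; omega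
    | node l r =>
      obtain ⟨t1, t2, e1, e2, e3⟩ := edges_node ht
      have l1 := l.leaves_pos
      have r1 := r.leaves_pos
      simp only [leaves] at hn
      obtain ⟨z, hz⟩ := hX.exists_eq 0 (0 + l.leaves) (0 + l.leaves + r.leaves) (by omega)
        (by omega) (by omega) e1 e2 e3
      exact ⟨z⟩
  have hle : H.ediam ≤ t.diam := by
    refine SimpleGraph.ediam_le_of_edist_le fun x y => ?_
    have hin : ∀ x, τ x ⊆ Finset.Icc 0 (0 + t.leaves) := by
      intro x
      obtain ⟨i, j, k, hij, hjk, hk, -, -, -, h⟩ := hX.eq_triple x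
      simp only [h, Finset.insert_subset_iff, Finset.singleton_subset_iff, Finset.mem_Icc]
      omega
    exact hX.edist_le_diam hE t (by omega) ht (hin x) (hin y)
  refine le_antisymm hle ?_
  obtain ⟨D, hD⟩ := ENat.ne_top_iff_exists.1 (ne_top_of_le_ne_top (ENat.natCast_ne_top _) hle)
  rw [← hD]
  exact_mod_cast hX.diam_le hE t (by omega) ht fun x y => hD ▸ SimpleGraph.edist_le_ediam

end IsTriangleGraph

namespace DualDiameter

/-! ### Signed areas in the plane -/

/-- Twice the signed area of the triangle `a b c`. -/
def orient (a b c : Plane) : ℝ := (b 0 - a 0) * (c 1 - a 1) - (b 1 - a 1) * (c 0 - a 0)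

theorem orient_rotate (a b c : Plane) : orient b c a = orient a b c := by
  simp only [orient]; ring

theorem orient_swap (a b c : Plane) : orient b a c = -orient a b c := by
  simp only [orient]; ring

theorem orient_swap_right (a b c : Plane) : orient a c b = -orient a b c := by
  simp only [orient]; ring

@[simp] theorem orient_self_left (a b : Plane) : orient a b a = 0 := by simp [orient]

@[simp] theorem orient_self_right (a b : Plane) : orient a b b = 0 := by
  simp only [orient]; ring

@[simp] theorem orient_self_self (a b : Plane) : orient a a b = 0 := by simp [orient]

theorem orient_combo (a b u v : Plane) {s t : ℝ} (h : s + t = 1) :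
    orient a b (s • u + t • v) = s * orient a b u + t * orient a b v := by
  obtain rfl : s = 1 - t := by linarith
  simp only [orient, PiLp.add_apply, PiLp.smul_apply, smul_eq_mul]
  ring

theorem continuous_orient (a b : Plane) : Continuous (orient a b) := by
  unfold orient; fun_prop

theorem convex_setOf_orient_nonneg (a b : Plane) : Convex ℝ {x | 0 ≤ orient a b x} := by
  intro x hx y hy s t hs ht hst
  simp only [Set.mem_ofPred_eq] at hx hy ⊢
  rw [orient_combo _ _ _ _ hst]
  positivity

theorem convex_setOf_orient_pos (a b : Plane) : Convex ℝ {x | 0 < orient a b x} := by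
  intro x hx y hy s t hs ht hst
  simp only [Set.mem_ofPred_eq] at hx hy ⊢
  rw [orient_combo _ _ _ _ hst]
  rcases hs.eq_or_lt with rfl | hs
  · obtain rfl : t = 1 := by linarith
    simpa using hy
  · positivity

theorem orient_nonpos_of_mem_segment {a b u v x : Plane} (hu : orient a b u ≤ 0)
    (hv : orient a b v ≤ 0) (hx : x ∈ segment ℝ u v) : orient a b x ≤ 0 := by
  have := (convex_setOf_orient_nonneg b a).segment_subset
    (by simpa [orient_swap a b] using hu) (by simpa [orient_swap a b] using hv) hx
  simpa [orient_swap a b] using this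

theorem barycentric {a b c : Plane} (h : orient a b c ≠ 0) (x : Plane) :
    x = (orient b c x / orient a b c) • a + (orient c a x / orient a b c) • b +
      (orient a b x / orient a b c) • c := by
  ext i
  simp only [PiLp.add_apply, PiLp.smul_apply, smul_eq_mul]
  field_simp
  fin_cases i <;> simp [orient] <;> ring

theorem barycentric_sum {a b c : Plane} (h : orient a b c ≠ 0) (x : Plane) :
    orient b c x / orient a b c + orient c a x / orient a b c +
      orient a b x / orient a b c = 1 := by
  field_simp
  simp only [orient]; ring

theorem mem_convexHull_triple {a b c x : Plane} (h : 0 < orient a b c) (h1 : 0 ≤ orient a b x)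
    (h2 : 0 ≤ orient b c x) (h3 : 0 ≤ orient c a x) :
    x ∈ convexHull ℝ ({a, b, c} : Set Plane) := by
  rw [barycentric h.ne' x]
  have hs := barycentric_sum h.ne' x
  have := (convex_convexHull ℝ ({a, b, c} : Set Plane)).sum_mem (t := Finset.univ)
    (w := ![orient b c x / orient a b c, orient c a x / orient a b c,
      orient a b x / orient a b c]) (z := ![a, b, c])
    (by intro i _; fin_cases i <;> simp <;> positivity)
    (by simpa [Fin.sum_univ_three] using hs)
    (by intro i _; apply subset_convexHull; fin_cases i <;> simp)
  simpa [Fin.sum_univ_three] using this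

theorem mem_segment_of_orient_eq_zero {a b c x : Plane} (h : 0 < orient a b c)
    (h1 : orient a b x = 0) (h2 : 0 ≤ orient b c x) (h3 : 0 ≤ orient c a x) :
    x ∈ segment ℝ a b := by
  have e := barycentric h.ne' x
  have s := barycentric_sum h.ne' x
  rw [h1] at e s
  simp only [zero_div, zero_smul, add_zero] at e s
  exact ⟨_, _, by positivity, by positivity, s, e.symm⟩

theorem eq_endpoint_of_orient_eq_zero {a b u v x : Plane} (hu : 0 ≤ orient a b u)
    (hv : 0 ≤ orient a b v) (huv : orient a b u ≠ 0 ∨ orient a b v ≠ 0)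
    (hx : x ∈ segment ℝ u v) (h : orient a b x = 0) :
    (x = u ∧ orient a b u = 0) ∨ (x = v ∧ orient a b v = 0) := by
  obtain ⟨s, t, hs, ht, hst, rfl⟩ := hx
  rw [orient_combo _ _ _ _ hst] at h
  have h1 : s * orient a b u = 0 := by nlinarith [mul_nonneg hs hu, mul_nonneg ht hv]
  have h2 : t * orient a b v = 0 := by nlinarith [mul_nonneg hs hu, mul_nonneg ht hv]
  rcases mul_eq_zero.1 h1 with h3 | h3 <;> rcases mul_eq_zero.1 h2 with h4 | h4
  · exfalso; linarith
  · right
    obtain rfl : t = 1 := by linarith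
    exact ⟨by simp [h3], h4⟩
  · left
    obtain rfl : s = 1 := by linarith
    exact ⟨by simp [h4], h3⟩
  · exact absurd h4 (huv.resolve_left (not_not.2 h3))

/-! ### Ordering the vertices counterclockwise -/

/-- The points `p 0, …, p (n - 1)` are in convex position and listed counterclockwise. -/
def ConvexPosition (n : ℕ) (p : ℕ → Plane) : Prop :=
  ∀ i j k, i < j → j < k → k < n → 0 < orient (p i) (p j) (p k)

/-- Area zero means collinear, and one of three collinear points lies between the other two. -/
theorem orient_ne_zero {V : Set Plane} (hV : ∀ a ∈ V, ∀ b ∈ V, ∀ c ∈ V,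
    a ∈ segment ℝ b c → a = b ∨ a = c) {a b c : Plane} (ha : a ∈ V) (hb : b ∈ V) (hc : c ∈ V)
    (hab : a ≠ b) (hac : a ≠ c) (hbc : b ≠ c) : orient a b c ≠ 0 := by
  intro h
  have hcol : Collinear ℝ {a, b, c} := by
    rw [collinear_iff_of_mem (p₀ := a) (by simp)]
    refine ⟨b - a, ?_⟩
    have key : ∃ r : ℝ, c = r • (b - a) + a := by
      by_cases h0 : b 0 - a 0 = 0
      · have h1 : b 1 - a 1 ≠ 0 := by
          intro h1
          apply hab
          ext i
          fin_cases i
          · simp only [Fin.zero_eta]; linarith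
          · simp only [Fin.mk_one]; linarith
        refine ⟨(c 1 - a 1) / (b 1 - a 1), ?_⟩
        simp only [orient, h0, zero_mul, zero_sub, neg_eq_zero, mul_eq_zero, h1, false_or] at h
        ext i
        fin_cases i
        · simp [h0]; linarith
        · simp [h1]
      · refine ⟨(c 0 - a 0) / (b 0 - a 0), ?_⟩
        simp only [orient] at h
        ext i
        fin_cases i
        · simp [h0]
        · simp; field_simp; linarith
    obtain ⟨r, hr⟩ := key
    rintro x (rfl | rfl | rfl)
    · exact ⟨0, by simp⟩
    · exact ⟨1, by simp⟩
    · exact ⟨r, by simpa using hr⟩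
  rcases hcol.wbtw_or_wbtw_or_wbtw with h | h | h
  · rcases hV b hb a ha c hc (mem_segment_iff_wbtw.2 h) with h | h
    · exact hab h.symm
    · exact hbc h
  · rcases hV c hc b hb a ha (mem_segment_iff_wbtw.2 h) with h | h
    · exact hbc h.symm
    · exact hac h.symm
  · rcases hV a ha c hc b hb (mem_segment_iff_wbtw.2 h) with h | h
    · exact hac h
    · exact hab h

theorem exists_strictMono_enumeration {α : Type*} (W : Finset α) (f : α → ℝ)
    (hf : Set.InjOn f W) : ∃ q : Fin W.card → α, (∀ i, q i ∈ W) ∧ (∀ w ∈ W, ∃ i, q i = w) ∧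
      StrictMono (f ∘ q) := by
  classical
  have hc : (W.image f).card = W.card := Finset.card_image_of_injOn hf
  let g := (W.image f).orderEmbOfFin hc
  have hg : ∀ i, ∃ w ∈ W, f w = g i := fun i =>
    Finset.mem_image.1 (Finset.orderEmbOfFin_mem _ hc i)
  choose q hq hq' using hg
  refine ⟨q, hq, fun w hw => ?_, fun i j hij => ?_⟩
  · have : f w ∈ Set.range g := by
      rw [Finset.range_orderEmbOfFin]
      exact_mod_cast Finset.mem_image_of_mem f hw
    obtain ⟨i, hi⟩ := this
    exact ⟨i, hf (hq i) hw ((hq' i).trans hi)⟩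
  · simp only [Function.comp, hq']
    exact g.strictMono hij

/-- The points are sorted by direction as seen from one extreme point o. Triples containing o are
then positively oriented; for any other triple i < j < m, a non-positive orientation would put p j
into the triangle o, p i, p m. -/
theorem exists_convexPosition {V : Set Plane} {n : ℕ} (hn : 3 ≤ n) (hcard : V.ncard = n)
    (hV : ∀ v ∈ V, ∀ s : Set Plane, s ⊆ V → v ∈ convexHull ℝ s → v ∈ s) :
    ∃ p : ℕ → Plane, (∀ i < n, p i ∈ V) ∧ (∀ v ∈ V, ∃ i < n, p i = v) ∧
      ConvexPosition n p := by
  classical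
  have hfin : V.Finite := Set.finite_of_ncard_ne_zero (by omega)
  have hne : V.Nonempty := Set.nonempty_of_ncard_ne_zero (by omega)
  obtain ⟨o, ho, hmax⟩ := Set.exists_max_image V (fun v => ‖v‖) hfin hne
  have hseg : ∀ a ∈ V, ∀ b ∈ V, ∀ c ∈ V, a ∈ segment ℝ b c → a = b ∨ a = c := by
    intro a ha b hb c hc h
    have := hV a ha {b, c} (Set.insert_subset hb (Set.singleton_subset_iff.2 hc))
      (by rwa [convexHull_pair])
    simpa using this
  -- With o farthest from the origin, 2 l v = |o|² - |v|² + |o - v|² is positive for every other v.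
  -- All directions thus lie in an open half-plane, and the slope k / l orders them.
  let l : Plane → ℝ := fun v => o 0 * (o 0 - v 0) + o 1 * (o 1 - v 1)
  let k : Plane → ℝ := fun v => o 0 * (o 1 - v 1) - o 1 * (o 0 - v 0)
  have hl : ∀ v ∈ V, v ≠ o → 0 < l v := by
    intro v hv hvo
    have h1 := hmax v hv
    have h2 : ‖v‖ ^ 2 ≤ ‖o‖ ^ 2 := by gcongr
    simp only [EuclideanSpace.norm_sq_eq, Fin.sum_univ_two, Real.norm_eq_abs, sq_abs] at h2
    have h3 : 0 < (o 0 - v 0) ^ 2 + (o 1 - v 1) ^ 2 := by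
      by_contra h
      have e0 : o 0 - v 0 = 0 := by nlinarith [sq_nonneg (o 0 - v 0), sq_nonneg (o 1 - v 1)]
      have e1 : o 1 - v 1 = 0 := by nlinarith [sq_nonneg (o 0 - v 0), sq_nonneg (o 1 - v 1)]
      apply hvo
      ext i
      fin_cases i
      · simp only [Fin.zero_eta]; linarith
      · simp only [Fin.mk_one]; linarith
    simp only [l]
    nlinarith
  have hkey : ∀ u ∈ V, ∀ v ∈ V, u ≠ o → v ≠ o → k u / l u < k v / l v → 0 < orient o u v := by
    intro u hu v hv huo hvo h
    rw [div_lt_div_iff₀ (hl u hu huo) (hl v hv hvo)] at h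
    have e : k v * l u - k u * l v = (o 0 ^ 2 + o 1 ^ 2) * orient o u v := by
      simp only [k, l, orient]; ring
    exact pos_of_mul_pos_right (by rw [← e]; linarith) (by positivity)
  have hkey' : ∀ u ∈ V, ∀ v ∈ V, u ≠ o → v ≠ o → k u / l u = k v / l v → u = v := by
    intro u hu v hv huo hvo h
    by_contra huv
    rw [div_eq_div_iff (hl u hu huo).ne' (hl v hv hvo).ne'] at h
    have e : k v * l u - k u * l v = (o 0 ^ 2 + o 1 ^ 2) * orient o u v := by
      simp only [k, l, orient]; ring
    have h1 := orient_ne_zero hseg ho hu hv huo.symm hvo.symm huv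
    have h2 : (o 0 ^ 2 + o 1 ^ 2) = 0 := by
      by_contra h2
      exact mul_ne_zero h2 h1 (by rw [← e]; linarith)
    have h3 := hl u hu huo
    have e0 : o 0 = 0 := by nlinarith [sq_nonneg (o 0), sq_nonneg (o 1)]
    have e1 : o 1 = 0 := by nlinarith [sq_nonneg (o 0), sq_nonneg (o 1)]
    simp [l, e0, e1] at h3
  let W : Finset Plane := hfin.toFinset.erase o
  have hW : ∀ v, v ∈ W ↔ v ≠ o ∧ v ∈ V := by simp [W]
  have hWc : W.card + 1 = n := by
    rw [← hcard, Set.ncard_eq_toFinset_card V hfin]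
    exact Finset.card_erase_add_one (by simpa using ho)
  obtain ⟨q, q1, q2, q3⟩ := exists_strictMono_enumeration W (fun v => k v / l v) (by
    intro u hu v hv h
    obtain ⟨hu1, hu2⟩ := (hW u).1 hu
    obtain ⟨hv1, hv2⟩ := (hW v).1 hv
    exact hkey' u hu2 v hv2 hu1 hv1 h)
  let p : ℕ → Plane := fun i => if h : 1 ≤ i ∧ i < n then q ⟨i - 1, by omega⟩ else o
  have p0 : p 0 = o := by simp [p]
  have pW : ∀ i, 1 ≤ i → i < n → p i ∈ W := fun i h1 h2 => by simp [p, h1, h2, q1]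
  have pV : ∀ i < n, p i ∈ V := by
    intro i hi
    rcases Nat.eq_zero_or_pos i with rfl | h
    · rwa [p0]
    · exact ((hW _).1 (pW i h hi)).2
  have pos : ∀ i j, 1 ≤ i → i < j → j < n → 0 < orient o (p i) (p j) := by
    intro i j h1 h2 h3
    have a1 := (hW _).1 (pW i h1 (by omega))
    have a2 := (hW _).1 (pW j (by omega) h3)
    refine hkey _ a1.2 _ a2.2 a1.1 a2.1 ?_
    simp only [p, dif_pos (show 1 ≤ i ∧ i < n by omega), dif_pos (show 1 ≤ j ∧ j < n by omega)]
    refine q3 ?_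
    simp only [Fin.mk_lt_mk]; omega
  refine ⟨p, pV, fun v hv => ?_, fun i j m hij hjm hm => ?_⟩
  · by_cases hvo : v = o
    · exact ⟨0, by omega, by rw [p0, hvo]⟩
    · obtain ⟨i, hi⟩ := q2 v ((hW v).2 ⟨hvo, hv⟩)
      have := i.2
      exact ⟨i + 1, by omega, by simp [p, ← hi, show (i : ℕ) + 1 < n by omega]⟩
  · rcases Nat.eq_zero_or_pos i with rfl | hi
    · rw [p0]; exact pos _ _ (by omega) hjm hm
    · by_contra hneg
      have b1 := pos i j hi hij (by omega)
      have b2 := pos j m (by omega) hjm hm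
      have b3 := pos i m hi (by omega) hm
      have := hV (p j) (pV j (by omega)) {o, p i, p m} (by
          rintro x (rfl | rfl | rfl)
          · exact ho
          · exact pV i (by omega)
          · exact pV m hm)
        (mem_convexHull_triple b3 b1.le
          (by rw [orient_swap_right]; linarith)
          (by rw [orient_rotate, orient_rotate]; exact b2.le))
      rcases this with h | h | h
      · exact ((hW _).1 (pW j (by omega) (by omega))).1 h
      · rw [h] at b1; simp at b1
      · rw [Set.mem_singleton_iff.1 h] at b2; simp at b2

namespace ConvexPosition

variable {n : ℕ} {p : ℕ → Plane}

theorem orient_pos_of_lt (hp : ConvexPosition n p) {i j u : ℕ} (hui : u < i) (hij : i < j)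
    (hj : j < n) : 0 < orient (p i) (p j) (p u) := by
  rw [orient_rotate]; exact hp u i j hui hij hj

theorem orient_neg (hp : ConvexPosition n p) {i j u : ℕ} (hiu : i < u) (huj : u < j)
    (hj : j < n) : orient (p i) (p j) (p u) < 0 := by
  rw [orient_swap_right]; linarith [hp i u j hiu huj hj]

theorem orient_nonpos (hp : ConvexPosition n p) {i j u : ℕ} (hiu : i ≤ u) (huj : u ≤ j)
    (hj : j < n) : orient (p i) (p j) (p u) ≤ 0 := by
  rcases hiu.eq_or_lt with rfl | h1
  · simp
  rcases huj.eq_or_lt with rfl | h2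
  · simp
  exact (hp.orient_neg h1 h2 hj).le

theorem orient_nonneg (hp : ConvexPosition n p) {i j u : ℕ} (hij : i < j)
    (hj : j < n) (hu : u < n) (h : u ≤ i ∨ j ≤ u) : 0 ≤ orient (p i) (p j) (p u) := by
  rcases h with h | h
  · rcases h.eq_or_lt with rfl | h1
    · simp
    exact (hp.orient_pos_of_lt h1 hij hj).le
  · rcases h.eq_or_lt with rfl | h2
    · simp
    exact (hp _ _ _ hij h2 hu).le

theorem orient_eq_zero (hp : ConvexPosition n p) {i j u : ℕ} (hij : i < j) (hj : j < n)
    (hu : u < n) (h : orient (p i) (p j) (p u) = 0) : u = i ∨ u = j := by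
  rcases lt_trichotomy u i with h1 | h1 | h1
  · exact absurd h (hp.orient_pos_of_lt h1 hij hj).ne'
  · exact .inl h1
  rcases lt_trichotomy u j with h2 | h2 | h2
  · exact absurd h (hp.orient_neg h1 h2 hj).ne
  · exact .inr h2
  · exact absurd h (hp _ _ _ hij h2 hu).ne'

theorem injective (hp : ConvexPosition n p) (hn : 3 ≤ n) {i j : ℕ} (hi : i < n) (hj : j < n)
    (h : p i = p j) : i = j := by
  by_contra hne
  wlog hij : i < j generalizing i j
  · exact this hj hi h.symm (Ne.symm hne) (by omega)
  obtain ⟨k, hk, hki, hkj⟩ : ∃ k < n, k ≠ i ∧ k ≠ j := by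
    by_contra! h
    have h0 := h 0 (by omega)
    have h1 := h 1 (by omega)
    have h2 := h 2 (by omega)
    omega
  have := hp.orient_eq_zero hij hj hk (by rw [h]; simp)
  omega

theorem exists_mem_segment_inter (hp : ConvexPosition n p) {i j k l : ℕ} (hij : i < j)
    (hjk : j < k) (hkl : k < l) (hl : l < n) :
    (segment ℝ (p i) (p k) ∩ segment ℝ (p j) (p l)).Nonempty := by
  have a1 := hp j k l hjk hkl hl
  have a2 := hp i k l (by omega) hkl hl
  have a3 := hp i j l hij (by omega) hl
  have a4 := hp i j k hij hjk (by omega)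
  set A := orient (p j) (p k) (p l) with hA
  set B := orient (p i) (p k) (p l) with hB
  set C := orient (p i) (p j) (p l) with hC
  set D := orient (p i) (p j) (p k) with hD
  -- Both sums are twice the area of the quadrilateral, cut along either diagonal; the diagonals
  -- divide each other in the ratios A : C and B : D.
  have e : A + C = B + D := by simp only [hA, hB, hC, hD, orient]; ring
  refine ⟨(A / (A + C)) • p i + (C / (A + C)) • p k,
    ⟨_, _, by positivity, by positivity, by field_simp, rfl⟩,
    ⟨B / (A + C), D / (A + C), by positivity, by positivity, by field_simp; linarith, ?_⟩⟩
  ext m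
  simp only [PiLp.add_apply, PiLp.smul_apply, smul_eq_mul]
  field_simp
  fin_cases m <;> simp only [hA, hB, hC, hD, orient, Fin.zero_eta, Fin.mk_one] <;> ring

/-- Labels that do not interleave put p c and p d on one closed side of the line through p a and p
b, and not both on it. A common point lies on that line, so it is an end of the second segment. -/
theorem segment_inter_subset (hp : ConvexPosition n p) {a b c d : ℕ} (hab : a < b) (hb : b < n)
    (hcd : c < d) (hd : d < n) (hne : ¬ (a = c ∧ b = d)) (h1 : ¬ (a < c ∧ c < b ∧ b < d))
    (h2 : ¬ (c < a ∧ a < d ∧ d < b)) :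
    segment ℝ (p a) (p b) ∩ segment ℝ (p c) (p d) ⊆ {p a, p b} ∩ {p c, p d} := by
  rintro x ⟨hx, hx'⟩
  have h0 : orient (p a) (p b) x = 0 := by
    obtain ⟨s, t, -, -, hst, rfl⟩ := hx
    rw [orient_combo _ _ _ _ hst]; simp
  have hc := hp.orient_eq_zero hab hb (u := c) (by omega)
  have hd' := hp.orient_eq_zero hab hb hd
  have hor : orient (p a) (p b) (p c) ≠ 0 ∨ orient (p a) (p b) (p d) ≠ 0 := by
    by_contra! h
    have := hc h.1
    have := hd' h.2
    omega
  suffices (x = p c ∧ orient (p a) (p b) (p c) = 0) ∨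
      (x = p d ∧ orient (p a) (p b) (p d) = 0) by
    rcases this with ⟨rfl, h⟩ | ⟨rfl, h⟩
    · rcases hc h with rfl | rfl <;> simp
    · rcases hd' h with rfl | rfl <;> simp
  by_cases hside : a ≤ c ∧ d ≤ b
  · have n1 : orient (p a) (p b) (p c) ≤ 0 := hp.orient_nonpos hside.1 (by omega) hb
    have n2 : orient (p a) (p b) (p d) ≤ 0 := hp.orient_nonpos (by omega) hside.2 hb
    have := eq_endpoint_of_orient_eq_zero (a := p b) (b := p a) (u := p c) (v := p d) (x := x)
      (by rw [orient_swap]; linarith) (by rw [orient_swap]; linarith)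
      (by simpa only [orient_swap (p a), ne_eq, neg_eq_zero] using hor) hx'
      (by rw [orient_swap, h0, neg_zero])
    simpa only [orient_swap (p a), ne_eq, neg_eq_zero] using this
  · exact eq_endpoint_of_orient_eq_zero (hp.orient_nonneg hab hb (by omega) (by omega))
      (hp.orient_nonneg hab hb hd (by omega)) hor hx' h0

end ConvexPosition

/-! ### Open and closed triangles -/

/-- The open triangle with counterclockwise corners `a`, `b`, `c`. -/
def openTriangle (a b c : Plane) : Set Plane :=
  {x | 0 < orient a b x ∧ 0 < orient b c x ∧ 0 < orient c a x}

/-- The closed triangle with counterclockwise corners `a`, `b`, `c`. -/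
def closedTriangle (a b c : Plane) : Set Plane :=
  {x | 0 ≤ orient a b x ∧ 0 ≤ orient b c x ∧ 0 ≤ orient c a x}

theorem isOpen_openTriangle (a b c : Plane) : IsOpen (openTriangle a b c) :=
  (isOpen_lt continuous_const (continuous_orient _ _)).inter
    ((isOpen_lt continuous_const (continuous_orient _ _)).inter
      (isOpen_lt continuous_const (continuous_orient _ _)))

theorem isClosed_closedTriangle (a b c : Plane) : IsClosed (closedTriangle a b c) :=
  (isClosed_le continuous_const (continuous_orient _ _)).inter
    ((isClosed_le continuous_const (continuous_orient _ _)).inter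
      (isClosed_le continuous_const (continuous_orient _ _)))

theorem convex_openTriangle (a b c : Plane) : Convex ℝ (openTriangle a b c) :=
  (convex_setOf_orient_pos _ _).inter
    ((convex_setOf_orient_pos _ _).inter (convex_setOf_orient_pos _ _))

theorem openTriangle_subset_closedTriangle (a b c : Plane) :
    openTriangle a b c ⊆ closedTriangle a b c := fun _ h => ⟨h.1.le, h.2.1.le, h.2.2.le⟩

theorem openTriangle_nonempty {a b c : Plane} (h : 0 < orient a b c) :
    (openTriangle a b c).Nonempty := by
  refine ⟨(2 / 3 : ℝ) • ((1 / 2 : ℝ) • a + (1 / 2 : ℝ) • b) + (1 / 3 : ℝ) • c, ?_, ?_, ?_⟩ <;>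
  rw [orient_combo _ _ _ _ (by norm_num), orient_combo _ _ _ _ (by norm_num)] <;>
  simp only [orient_self_left, orient_self_right]
  · linarith
  · rw [orient_rotate]; linarith
  · rw [← orient_rotate, ← orient_rotate] at h; linarith

theorem closure_openTriangle {a b c : Plane} (h : 0 < orient a b c) :
    closure (openTriangle a b c) = closedTriangle a b c := by
  refine (closure_minimal (openTriangle_subset_closedTriangle a b c)
    (isClosed_closedTriangle a b c)).antisymm fun x hx => ?_
  obtain ⟨y, hy⟩ := openTriangle_nonempty h
  refine closure_mono ?_ (segment_subset_closure_openSegment (left_mem_segment ℝ x y))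
  rintro z ⟨s, t, hs, ht, hst, rfl⟩
  obtain ⟨x1, x2, x3⟩ := hx
  obtain ⟨y1, y2, y3⟩ := hy
  refine ⟨?_, ?_, ?_⟩ <;> rw [orient_combo _ _ _ _ hst] <;> positivity

theorem isBounded_openTriangle {a b c : Plane} (h : 0 < orient a b c) :
    Bornology.IsBounded (openTriangle a b c) :=
  ((Set.toFinite {a, b, c}).isCompact_convexHull (𝕜 := ℝ)).isBounded.subset fun _ hx =>
    mem_convexHull_triple h hx.1.le hx.2.1.le hx.2.2.le

theorem ConvexPosition.mem_closedTriangle_iff {n : ℕ} {p : ℕ → Plane} (hp : ConvexPosition n p)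
    {i j k u : ℕ} (hij : i < j) (hjk : j < k) (hk : k < n) (hu : u < n) :
    p u ∈ closedTriangle (p i) (p j) (p k) ↔ u = i ∨ u = j ∨ u = k := by
  constructor
  · rintro ⟨h1, h2, h3⟩
    by_contra! h
    rw [orient_swap] at h3
    rcases lt_trichotomy u i with h4 | h4 | h4
    · linarith [hp.orient_pos_of_lt h4 (hij.trans hjk) hk]
    · omega
    rcases lt_trichotomy u j with h5 | h5 | h5
    · linarith [hp.orient_neg h4 h5 (by omega)]
    · omega
    rcases lt_trichotomy u k with h6 | h6 | h6
    · linarith [hp.orient_neg h5 h6 (by omega)]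
    · omega
    · linarith [hp i k u (by omega) h6 hu]
  · have := (hp i j k hij hjk hk).le
    rintro (rfl | rfl | rfl)
    · exact ⟨by simp, by rwa [orient_rotate], by simp⟩
    · exact ⟨by simp, by simp, by rwa [← orient_rotate, ← orient_rotate] at this⟩
    · exact ⟨this, by simp, by simp⟩

/-! ### Labelled polygons and their chords -/

/-- `p 0, …, p (n - 1)` is a counterclockwise list of the vertices of the convex polygon `P`. -/
structure IsLabelling (P : Set Plane) (n : ℕ) (p : ℕ → Plane) : Prop where
  three_le : 3 ≤ n
  mem : ∀ i < n, p i ∈ vertices P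
  exists_eq : ∀ v ∈ vertices P, ∃ i < n, p i = v
  convexPosition : ConvexPosition n p
  convexHull_eq : convexHull ℝ (vertices P) = P

theorem IsConvexPolygon.exists_isLabelling {P : Set Plane} (hP : IsConvexPolygon P) {n : ℕ}
    (hn : 3 ≤ n) (hV : (vertices P).ncard = n) : ∃ p, IsLabelling P n p := by
  obtain ⟨⟨S, hS⟩, -⟩ := hP
  have hfin : (vertices P).Finite := Set.finite_of_ncard_ne_zero (by omega)
  have hconv : Convex ℝ P := hS ▸ convex_convexHull ℝ _
  have hcomp : IsCompact P := hS ▸ S.finite_toSet.isCompact_convexHull (𝕜 := ℝ)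
  have hhull : convexHull ℝ (vertices P) = P := by
    have : closure (convexHull ℝ (vertices P)) = P :=
      closure_convexHull_extremePoints hcomp hconv
    rwa [(Set.Finite.isCompact_convexHull ℝ hfin).isClosed.closure_eq] at this
  obtain ⟨p, h1, h2, h3⟩ := exists_convexPosition hn hV (by
    intro v hv s hs hvs
    have hsP : convexHull ℝ s ⊆ P := by
      conv_rhs => rw [← hhull]
      exact convexHull_mono hs
    exact extremePoints_convexHull_subset
      (inter_extremePoints_subset_extremePoints_of_subset hsP ⟨hvs, hv⟩))
  exact ⟨p, hn, h1, h2, h3, hhull⟩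

/-- The edges of a geometric graph in terms of a labelling of the vertices. -/
def chord {V : Set Plane} (G : SimpleGraph V) (n : ℕ) (p : ℕ → Plane) (i j : ℕ) : Prop :=
  i < n ∧ j < n ∧ ∃ (hi : p i ∈ V) (hj : p j ∈ V), G.Adj ⟨p i, hi⟩ ⟨p j, hj⟩

theorem chord_symm {V : Set Plane} {G : SimpleGraph V} {n : ℕ} {p : ℕ → Plane} {i j : ℕ}
    (h : chord G n p i j) : chord G n p j i :=
  let ⟨hi, hj, h1, h2, h3⟩ := h
  ⟨hj, hi, h2, h1, h3.symm⟩

theorem chord_ne {V : Set Plane} {G : SimpleGraph V} {n : ℕ} {p : ℕ → Plane} {i j : ℕ}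
    (h : chord G n p i j) : i ≠ j := by
  rintro rfl
  obtain ⟨-, -, h1, h2, h3⟩ := h
  exact h3.ne rfl

theorem segment_subset_drawing {V : Set Plane} {G : SimpleGraph V} {n : ℕ} {p : ℕ → Plane}
    {i j : ℕ} (h : chord G n p i j) : segment ℝ (p i) (p j) ⊆ drawing G := by
  obtain ⟨-, -, h1, h2, h3⟩ := h
  exact fun x hx => .inr ⟨_, _, h3, hx⟩

/-- Away from the three sides the plane is the disjoint union of two open sets, the open triangle
and the complement of the closed one. -/
theorem subset_openTriangle_of_isPreconnected {a b c : Plane} (h : 0 < orient a b c)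
    {C : Set Plane} (hC : IsPreconnected C) (hab : Disjoint C (segment ℝ a b))
    (hbc : Disjoint C (segment ℝ b c)) (hca : Disjoint C (segment ℝ c a))
    (hne : (C ∩ openTriangle a b c).Nonempty) : C ⊆ openTriangle a b c := by
  refine hC.subset_left_of_subset_union (isOpen_openTriangle a b c)
    (isClosed_closedTriangle a b c).isOpen_compl ?_ ?_ hne
  · exact disjoint_compl_right.mono_left (openTriangle_subset_closedTriangle a b c)
  · intro x hx
    by_cases hx' : x ∈ closedTriangle a b c
    · left
      obtain ⟨h1, h2, h3⟩ := hx'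
      refine ⟨h1.lt_of_ne fun h0 => ?_, h2.lt_of_ne fun h0 => ?_, h3.lt_of_ne fun h0 => ?_⟩
      · exact hab.le_bot ⟨hx, mem_segment_of_orient_eq_zero h h0.symm h2 h3⟩
      · exact hbc.le_bot ⟨hx, mem_segment_of_orient_eq_zero (by rwa [orient_rotate]) h0.symm
          h3 h1⟩
      · exact hca.le_bot ⟨hx, mem_segment_of_orient_eq_zero
          (by rwa [orient_rotate, orient_rotate]) h0.symm h1 h2⟩
    · exact .inr hx'

namespace IsLabelling

variable {P : Set Plane} {n : ℕ} {p : ℕ → Plane}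

theorem convex (hp : IsLabelling P n p) : Convex ℝ P :=
  hp.convexHull_eq ▸ convex_convexHull ℝ _

theorem finite (hp : IsLabelling P n p) : (vertices P).Finite :=
  ((Set.finite_Iio n).image p).subset fun v hv => by
    obtain ⟨i, hi, rfl⟩ := hp.exists_eq v hv
    exact ⟨i, hi, rfl⟩

theorem isClosed (hp : IsLabelling P n p) : IsClosed P :=
  hp.convexHull_eq ▸ (hp.finite.isCompact_convexHull (𝕜 := ℝ)).isClosed

theorem edgesInside (hp : IsLabelling P n p) (G : SimpleGraph (vertices P)) : EdgesInside P G :=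
  fun u v _ => hp.convex.segment_subset u.2.1 v.2.1

theorem drawing_subset (hp : IsLabelling P n p) (G : SimpleGraph (vertices P)) :
    drawing G ⊆ P := by
  rintro x (hx | ⟨u, v, huv, hx⟩)
  · exact hx.1
  · exact hp.edgesInside G u v huv hx

theorem injective (hp : IsLabelling P n p) {i j : ℕ} (hi : i < n) (hj : j < n)
    (h : p i = p j) : i = j := hp.convexPosition.injective hp.three_le hi hj h

theorem exists_chord (hp : IsLabelling P n p) {G : SimpleGraph (vertices P)} {u v : vertices P}
    (h : G.Adj u v) : ∃ i j, chord G n p i j ∧ (u : Plane) = p i ∧ (v : Plane) = p j := by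
  obtain ⟨i, hi, hu⟩ := hp.exists_eq u u.2
  obtain ⟨j, hj, hv⟩ := hp.exists_eq v v.2
  refine ⟨i, j, ⟨hi, hj, hp.mem i hi, hp.mem j hj, ?_⟩, hu.symm, hv.symm⟩
  convert h

theorem exists_chord_lt (hp : IsLabelling P n p) {G : SimpleGraph (vertices P)}
    {u v : vertices P} (h : G.Adj u v) : ∃ i j, i < j ∧ chord G n p i j ∧
      ((u : Plane) = p i ∧ (v : Plane) = p j ∨ (u : Plane) = p j ∧ (v : Plane) = p i) := by
  obtain ⟨i, j, hij, hu, hv⟩ := hp.exists_chord h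
  rcases (chord_ne hij).lt_or_gt with h | h
  · exact ⟨i, j, h, hij, .inl ⟨hu, hv⟩⟩
  · exact ⟨j, i, h, chord_symm hij, .inr ⟨hu, hv⟩⟩

/-- Only interleaving matters: no vertex lies inside an edge, because vertices are extreme points.
-/
theorem crossingFree_iff (hp : IsLabelling P n p) (G : SimpleGraph (vertices P)) :
    CrossingFree G ↔ NonCrossing (chord G n p) := by
  constructor
  · rintro ⟨-, hG⟩ i j k l hij hjk hkl ⟨hi, hk, hi', hk', hik⟩ ⟨hj, hl, hj', hl', hjl⟩
    obtain ⟨x, hx⟩ := hp.convexPosition.exists_mem_segment_inter hij hjk hkl hl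
    have hne : ∀ {a b}, a < n → b < n → a ≠ b → p a ≠ p b := fun ha hb hab h =>
      hab (hp.injective ha hb h)
    have := hG _ _ _ _ hik hjl (by
      intro h
      rw [Sym2.eq_iff] at h
      simp only [Subtype.mk.injEq] at h
      rcases h with ⟨h, -⟩ | ⟨h, -⟩
      · exact hne hi hj (by omega) h
      · exact hne hi hl (by omega) h) hx
    simp only [Set.mem_inter_iff, Set.mem_insert_iff, Set.mem_singleton_iff] at this
    obtain ⟨rfl | rfl, h | h⟩ := this
    · exact hne hi hj (by omega) h
    · exact hne hi hl (by omega) h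
    · exact hne hk hj (by omega) h
    · exact hne hk hl (by omega) h
  · intro hG
    refine ⟨fun u v w huv hw => ?_, fun u v w z huv hwz hne => ?_⟩
    · have := (mem_extremePoints_iff_forall_segment.1 w.2).2 _ u.2.1 _ v.2.1 hw
      rcases this with h | h
      · exact .inl (Subtype.ext h.symm)
      · exact .inr (Subtype.ext h.symm)
    · obtain ⟨a, b, hab, cab, h1⟩ := hp.exists_chord_lt huv
      obtain ⟨c, d, hcd, ccd, h2⟩ := hp.exists_chord_lt hwz
      have key := hp.convexPosition.segment_inter_subset hab cab.2.1 hcd ccd.2.1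
        (by
          rintro ⟨rfl, rfl⟩
          apply hne
          rw [Sym2.eq_iff]
          simp only [Subtype.ext_iff]
          rcases h1 with h1 | h1 <;> rcases h2 with h2 | h2 <;> simp [h1, h2])
        (fun h => hG a c b d h.1 h.2.1 h.2.2 cab ccd)
        (fun h => hG c a d b h.1 h.2.1 h.2.2 ccd cab)
      rcases h1 with h1 | h1 <;> rcases h2 with h2 | h2 <;> rw [h1.1, h1.2, h2.1, h2.2]
      · exact key
      · rwa [segment_symm ℝ (p d), Set.pair_comm (p d)]
      · rwa [segment_symm ℝ (p b), Set.pair_comm (p b)]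
      · rwa [segment_symm ℝ (p d), Set.pair_comm (p d), segment_symm ℝ (p b),
          Set.pair_comm (p b)]

theorem nonCrossing (hp : IsLabelling P n p) {T : SimpleGraph (vertices P)}
    (hT : IsTriangulation P T) : NonCrossing (chord T n p) :=
  (hp.crossingFree_iff T).1 hT.prop.1

theorem chord_of_not_crossing (hp : IsLabelling P n p) {T : SimpleGraph (vertices P)}
    (hT : IsTriangulation P T) {i j : ℕ} (hij : i < j) (hj : j < n)
    (h : ∀ k l, chord T n p k l → k < l →
      ¬ (k < i ∧ i < l ∧ l < j) ∧ ¬ (i < k ∧ k < j ∧ j < l)) : chord T n p i j := by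
  have hi : i < n := hij.trans hj
  let u : vertices P := ⟨p i, hp.mem i hi⟩
  let v : vertices P := ⟨p j, hp.mem j hj⟩
  have huv : u ≠ v := fun h => hij.ne (hp.injective hi hj (congrArg Subtype.val h))
  have hchord : ∀ k l, k < l → chord (T ⊔ SimpleGraph.edge u v) n p k l →
      chord T n p k l ∨ (k = i ∧ l = j) := by
    rintro k l hkl ⟨hk, hl, hk', hl', h | h⟩
    · exact .inl ⟨hk, hl, hk', hl', h⟩
    · right
      rw [SimpleGraph.edge_adj] at h
      simp only [u, v, Subtype.mk.injEq] at h
      rcases h.1 with ⟨h1, h2⟩ | ⟨h1, h2⟩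
      · exact ⟨hp.injective hk hi h1, hp.injective hl hj h2⟩
      · have := hp.injective hk hj h1
        have := hp.injective hl hi h2
        omega
  have hle : T ⊔ SimpleGraph.edge u v ≤ T := by
    refine hT.le_of_ge ⟨(hp.crossingFree_iff _).2 ?_, hp.edgesInside _⟩ le_sup_left
    intro a b c d hab hbc hcd h1 h2
    rcases hchord _ _ (by omega) h1 with h3 | ⟨rfl, rfl⟩ <;>
    rcases hchord _ _ (by omega) h2 with h4 | ⟨rfl, rfl⟩
    · exact hp.nonCrossing hT a b c d hab hbc hcd h3 h4
    · exact (h a c h3 (by omega)).1 ⟨hab, hbc, hcd⟩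
    · exact (h b d h4 (by omega)).2 ⟨hab, hbc, hcd⟩
    · omega
  refine ⟨hi, hj, hp.mem i hi, hp.mem j hj, hle ?_⟩
  right
  rw [SimpleGraph.edge_adj]
  exact ⟨.inl ⟨rfl, rfl⟩, huv⟩

theorem chord_succ (hp : IsLabelling P n p) {T : SimpleGraph (vertices P)}
    (hT : IsTriangulation P T) {i : ℕ} (hi : i + 1 < n) : chord T n p i (i + 1) :=
  hp.chord_of_not_crossing hT (by omega) hi fun k l _ _ => by omega

theorem chord_zero_last (hp : IsLabelling P n p) {T : SimpleGraph (vertices P)}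
    (hT : IsTriangulation P T) : chord T n p 0 (n - 1) :=
  have := hp.three_le
  hp.chord_of_not_crossing hT (by omega) (by omega) fun k l h _ => by have := h.2.1; omega

theorem exists_tree (hp : IsLabelling P n p) {T : SimpleGraph (vertices P)}
    (hT : IsTriangulation P T) :
    ∃ t : BinTree, t.leaves + 1 = n ∧ ∀ x y, t.edges 0 x y → chord T n p x y := by
  have := hp.three_le
  obtain ⟨t, h1, h2⟩ := (hp.nonCrossing hT).exists_tree
    (fun i j hij hj h => hp.chord_of_not_crossing hT hij hj h) (by omega)
    (by omega) (hp.chord_zero_last hT)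
  exact ⟨t, by omega, h2⟩

/-- The chords of `t` are enlarged to a maximal crossing-free graph. Whether the enlargement is
proper is irrelevant, since `dualDiameter_eq` only asks that the chords of `t` be present. -/
theorem exists_isTriangulation (hp : IsLabelling P n p) (t : BinTree) (ht : t.leaves + 1 = n) :
    ∃ T : SimpleGraph (vertices P), IsTriangulation P T ∧
      ∀ x y, t.edges 0 x y → chord T n p x y := by
  have := hp.finite.to_subtype
  let G : SimpleGraph (vertices P) := SimpleGraph.fromRel fun u v =>
    ∃ x y, t.edges 0 x y ∧ (u : Plane) = p x ∧ (v : Plane) = p y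
  have hG : NonCrossing (chord G n p) := by
    have key : ∀ i j, i < j → chord G n p i j → t.edges 0 i j := by
      rintro i j hij ⟨hi, hj, hi', hj', -, ⟨x, y, hxy, hx, hy⟩ | ⟨x, y, hxy, hx, hy⟩⟩ <;>
      have := t.edges_bounds hxy
      · rwa [hp.injective hi (by omega) hx, hp.injective hj (by omega) hy]
      · have := hp.injective hi (by omega) hy
        have := hp.injective hj (by omega) hx
        omega
    intro i j k l hij hjk hkl h1 h2
    exact t.edges_noncrossing hij hjk hkl (key _ _ (by omega) h1) (key _ _ (by omega) h2)
  obtain ⟨T, hGT, hT⟩ := Finite.exists_le_maximal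
    (p := fun G : SimpleGraph (vertices P) => CrossingFree G ∧ EdgesInside P G) (a := G)
    ⟨(hp.crossingFree_iff G).2 hG, hp.edgesInside G⟩
  refine ⟨T, hT, fun x y hxy => ?_⟩
  have := t.edges_bounds hxy
  have hx : x < n := by omega
  have hy : y < n := by omega
  refine ⟨hx, hy, hp.mem x hx, hp.mem y hy, hGT ?_⟩
  refine (SimpleGraph.fromRel_adj _ _ _).2 ⟨fun h => ?_, .inl ⟨x, y, hxy, rfl, rfl⟩⟩
  have := hp.injective hx hy (congrArg Subtype.val h)
  omega

/-! ### The bounded faces are open triangles -/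

theorem orient_pos_of_mem (hp : IsLabelling P n p) {a b : ℕ}
    (h : ∀ i < n, i ≠ a → i ≠ b → 0 < orient (p a) (p b) (p i)) {x : Plane} (hx : x ∈ P)
    (hxab : x ∉ segment ℝ (p a) (p b)) : 0 < orient (p a) (p b) x := by
  have hsub : vertices P ⊆ {p a, p b} ∪ {y | 0 < orient (p a) (p b) y} := by
    intro v hv
    obtain ⟨i, hi, rfl⟩ := hp.exists_eq v hv
    by_cases h1 : i = a
    · simp [h1]
    by_cases h2 : i = b
    · simp [h2]
    exact .inr (h i hi h1 h2)
  have hne : {y | 0 < orient (p a) (p b) y}.Nonempty := by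
    obtain ⟨k, hk, hka, hkb⟩ : ∃ k < n, k ≠ a ∧ k ≠ b := by
      by_contra! h
      have := hp.three_le
      have h0 := h 0 (by omega)
      have h1 := h 1 (by omega)
      have h2 := h 2 (by omega)
      omega
    exact ⟨p k, h k hk hka hkb⟩
  rw [← hp.convexHull_eq] at hx
  have hx' := convexHull_mono hsub hx
  rw [convexHull_union (by simp) hne, (convex_setOf_orient_pos _ _).convexHull_eq,
    convexHull_pair, mem_convexJoin] at hx'
  obtain ⟨y, hy, z, hz, s, t, hs, ht, hst, rfl⟩ := hx'
  have hy0 : orient (p a) (p b) y = 0 := by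
    obtain ⟨s', t', -, -, hst', rfl⟩ := hy
    rw [orient_combo _ _ _ _ hst']; simp
  rw [Set.mem_ofPred_eq] at hz
  rw [orient_combo _ _ _ _ hst, hy0, mul_zero, zero_add]
  rcases ht.eq_or_lt with rfl | ht
  · obtain rfl : s = 1 := by linarith
    exact (hxab (by simpa using hy)).elim
  · positivity

/-- Descent in the tree: x lies beyond the current chord. If it also lies beyond one of the two
child chords, continue there; otherwise it is in the triangle. A leaf is a side of the polygon,
beyond which x cannot lie. -/
theorem exists_mem_openTriangle_of_tree (hp : IsLabelling P n p) {T : SimpleGraph (vertices P)}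
    {x : Plane} (hx : x ∉ drawing T)
    (hside : ∀ i, i + 1 < n → 0 < orient (p i) (p (i + 1)) x) (t : BinTree) {a : ℕ}
    (hn : a + t.leaves < n) (ht : ∀ x y, t.edges a x y → chord T n p x y)
    (hxa : orient (p a) (p (a + t.leaves)) x < 0) :
    ∃ i j k, i < j ∧ j < k ∧ k < n ∧ chord T n p i j ∧ chord T n p j k ∧ chord T n p i k ∧
      x ∈ openTriangle (p i) (p j) (p k) := by
  induction t generalizing a with
  | leaf => exact absurd (hside a hn) hxa.not_gt
  | node l r hl hr =>
    obtain ⟨t1, t2, e1, e2, e3⟩ := IsTriangleGraph.edges_node ht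
    have l1 := l.leaves_pos
    have r1 := r.leaves_pos
    simp only [BinTree.leaves, ← add_assoc] at hn hxa
    by_cases h1 : orient (p a) (p (a + l.leaves)) x < 0
    · exact hl (by omega) t1 h1
    by_cases h2 : orient (p (a + l.leaves)) (p (a + l.leaves + r.leaves)) x < 0
    · exact hr (by omega) t2 h2
    have h0 := hp.convexPosition a (a + l.leaves) (a + l.leaves + r.leaves) (by omega)
      (by omega) hn
    have h3 : 0 < orient (p (a + l.leaves + r.leaves)) (p a) x := by
      rw [orient_swap]; linarith
    rw [not_lt] at h1 h2
    refine ⟨_, _, _, by omega, by omega, hn, e1, e2, e3, h1.lt_of_ne fun h => hx ?_,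
      h2.lt_of_ne fun h => hx ?_, h3⟩
    · exact segment_subset_drawing e1 (mem_segment_of_orient_eq_zero h0 h.symm h2 h3.le)
    · exact segment_subset_drawing e2
        (mem_segment_of_orient_eq_zero (by rwa [orient_rotate]) h.symm h3.le h1)

theorem exists_mem_openTriangle (hp : IsLabelling P n p) {T : SimpleGraph (vertices P)}
    (hT : IsTriangulation P T) {x : Plane} (hxP : x ∈ P) (hx : x ∉ drawing T) :
    ∃ i j k, i < j ∧ j < k ∧ k < n ∧ chord T n p i j ∧ chord T n p j k ∧ chord T n p i k ∧
      x ∈ openTriangle (p i) (p j) (p k) := by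
  have hn := hp.three_le
  obtain ⟨t, h1, h2⟩ := hp.exists_tree hT
  refine hp.exists_mem_openTriangle_of_tree hx (fun i hi => ?_) t (a := 0) (by omega) h2 ?_
  · refine hp.orient_pos_of_mem (fun u hu h3 h4 => ?_) hxP
      fun h => hx (segment_subset_drawing (hp.chord_succ hT hi) h)
    rcases Nat.lt_or_ge u i with h5 | h5
    · exact hp.convexPosition.orient_pos_of_lt h5 (by omega) hi
    · exact hp.convexPosition _ _ _ (by omega) (by omega) hu
  · rw [show 0 + t.leaves = n - 1 by omega, orient_swap, neg_neg_iff_pos]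
    refine hp.orient_pos_of_mem (fun u hu h3 h4 => ?_) hxP
      fun h => hx (segment_subset_drawing (hp.chord_zero_last hT) (by rwa [segment_symm]))
    rw [orient_swap, neg_pos]
    exact hp.convexPosition.orient_neg (by omega) (by omega) (by omega)

/-- Let f separate x from P. On the ray from x pointing away from p 0 the values of f increase
without bound, so the ray avoids P, stays in the component of x and makes it unbounded. -/
theorem not_isBounded_of_notMem (hp : IsLabelling P n p) (G : SimpleGraph (vertices P))
    {x : Plane} (hx : x ∉ P) :
    ¬ Bornology.IsBounded (connectedComponentIn (drawing G)ᶜ x) := by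
  intro hb
  obtain ⟨f, u, hf, hu⟩ := geometric_hahn_banach_closed_point hp.convex hp.isClosed hx
  have h0 : p 0 ∈ P := (hp.mem 0 (by have := hp.three_le; omega)).1
  have hpos : 0 < f (x - p 0) := by
    rw [map_sub]; linarith [hf _ h0]
  have hray : (fun t : ℝ => x + t • (x - p 0)) '' Set.Ici 0 ⊆
      connectedComponentIn (drawing G)ᶜ x := by
    refine IsPreconnected.subset_connectedComponentIn ?_ ⟨0, by simp, by simp⟩ ?_
    · exact isPreconnected_Ici.image _ (by fun_prop)
    · rintro _ ⟨t, ht, rfl⟩ hmem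
      have := hf _ (hp.drawing_subset G hmem)
      have := mul_nonneg (Set.mem_Ici.1 ht) hpos.le
      simp only [map_add, map_smul, smul_eq_mul] at *
      linarith
  obtain ⟨C, hC⟩ := ((f.lipschitz.isBounded_image hb)).bddAbove
  obtain ⟨t, ht⟩ := exists_nat_gt ((C - f x) / f (x - p 0))
  have := hC ⟨_, hray ⟨(t : ℝ), by simp, rfl⟩, rfl⟩
  rw [div_lt_iff₀ hpos] at ht
  simp only [map_add, map_smul, smul_eq_mul] at this
  linarith

theorem openTriangle_subset_compl_drawing (hp : IsLabelling P n p)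
    {G : SimpleGraph (vertices P)} (hG : NonCrossing (chord G n p)) {i j k : ℕ} (hij : i < j)
    (hjk : j < k) (hk : k < n) (h1 : chord G n p i j) (h2 : chord G n p j k)
    (h3 : chord G n p i k) : openTriangle (p i) (p j) (p k) ⊆ (drawing G)ᶜ := by
  -- A chord crossing no side of the triangle has both ends on one of the three arcs cut out by i,
  -- j, k, so it lies weakly beyond the corresponding side. The case u = v covers single vertices.
  have key : ∀ u v, u ≤ v → (u = v ∨ chord G n p u v) →
      (i ≤ u ∧ v ≤ j) ∨ (j ≤ u ∧ v ≤ k) ∨ ((u ≤ i ∨ k ≤ u) ∧ (v ≤ i ∨ k ≤ v)) := by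
    intro u v huv h
    by_contra hcon
    have h' := Or.resolve_left h (by omega)
    have h0 : i < u ∧ u < j ∧ j < v ∨ u < i ∧ i < v ∧ v < j ∨ j < u ∧ u < k ∧ k < v ∨
        u < j ∧ j < v ∧ v < k ∨ i < u ∧ u < k ∧ k < v ∨ u < i ∧ i < v ∧ v < k := by omega
    rcases h0 with h | h | h | h | h | h
    · exact hG i u j v h.1 h.2.1 h.2.2 h1 h'
    · exact hG u i v j h.1 h.2.1 h.2.2 h' h1
    · exact hG j u k v h.1 h.2.1 h.2.2 h2 h'
    · exact hG u j v k h.1 h.2.1 h.2.2 h' h2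
    · exact hG i u k v h.1 h.2.1 h.2.2 h3 h'
    · exact hG u i v k h.1 h.2.1 h.2.2 h' h3
  have main : ∀ u v, u ≤ v → v < n → (u = v ∨ chord G n p u v) →
      ∀ x ∈ segment ℝ (p u) (p v), x ∉ openTriangle (p i) (p j) (p k) := by
    rintro u v huv hv h x hx ⟨x1, x2, x3⟩
    have hc := hp.convexPosition
    rcases key u v huv h with ⟨a1, a2⟩ | ⟨a1, a2⟩ | ⟨a1, a2⟩
    · exact x1.not_ge (orient_nonpos_of_mem_segment (hc.orient_nonpos a1 (by omega) (by omega))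
        (hc.orient_nonpos (by omega) a2 (by omega)) hx)
    · exact x2.not_ge (orient_nonpos_of_mem_segment (hc.orient_nonpos a1 (by omega) hk)
        (hc.orient_nonpos (by omega) a2 hk) hx)
    · refine x3.not_ge (orient_nonpos_of_mem_segment ?_ ?_ hx) <;>
        rw [orient_swap, neg_nonpos] <;>
        exact hc.orient_nonneg (by omega) hk (by omega) (by assumption)
  rintro x hx (hxV | ⟨u, v, huv, hxuv⟩)
  · obtain ⟨u, hu, rfl⟩ := hp.exists_eq x hxV
    exact main u u le_rfl hu (.inl rfl) _ (left_mem_segment ℝ _ _) hx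
  · obtain ⟨a, b, hab, hc, ⟨e1, e2⟩ | ⟨e1, e2⟩⟩ := hp.exists_chord_lt huv <;>
      rw [e1, e2] at hxuv
    · exact main a b hab.le hc.2.1 (.inr hc) x hxuv hx
    · rw [segment_symm] at hxuv
      exact main a b hab.le hc.2.1 (.inr hc) x hxuv hx

theorem connectedComponentIn_eq (hp : IsLabelling P n p)
    {G : SimpleGraph (vertices P)} (hG : NonCrossing (chord G n p)) {i j k : ℕ} (hij : i < j)
    (hjk : j < k) (hk : k < n) (h1 : chord G n p i j) (h2 : chord G n p j k)
    (h3 : chord G n p i k) {x : Plane} (hx : x ∈ openTriangle (p i) (p j) (p k)) :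
    connectedComponentIn (drawing G)ᶜ x = openTriangle (p i) (p j) (p k) := by
  have hsub := hp.openTriangle_subset_compl_drawing hG hij hjk hk h1 h2 h3
  have hdis : ∀ {u v}, chord G n p u v →
      Disjoint (connectedComponentIn (drawing G)ᶜ x) (segment ℝ (p u) (p v)) := fun h =>
    Set.disjoint_left.2 fun y hy hy' =>
      connectedComponentIn_subset _ _ hy (segment_subset_drawing h hy')
  refine Set.Subset.antisymm ?_ ?_
  · exact subset_openTriangle_of_isPreconnected (hp.convexPosition i j k hij hjk hk)
      isPreconnected_connectedComponentIn (hdis h1) (hdis h2) (hdis (chord_symm h3))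
      ⟨x, mem_connectedComponentIn (hsub hx), hx⟩
  · exact (convex_openTriangle _ _ _).isPreconnected.subset_connectedComponentIn hx hsub

theorem isBoundedFace_iff (hp : IsLabelling P n p) {T : SimpleGraph (vertices P)}
    (hT : IsTriangulation P T) (F : Set Plane) : IsBoundedFace T F ↔
      ∃ i j k, i < j ∧ j < k ∧ k < n ∧ chord T n p i j ∧ chord T n p j k ∧ chord T n p i k ∧
        F = openTriangle (p i) (p j) (p k) := by
  have hG := hp.nonCrossing hT
  constructor
  · rintro ⟨⟨x, hx, rfl⟩, hb⟩
    have hxP : x ∈ P := by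
      by_contra h
      exact hp.not_isBounded_of_notMem T h hb
    obtain ⟨i, j, k, hij, hjk, hk, h1, h2, h3, h⟩ := hp.exists_mem_openTriangle hT hxP hx
    exact ⟨i, j, k, hij, hjk, hk, h1, h2, h3,
      hp.connectedComponentIn_eq hG hij hjk hk h1 h2 h3 h⟩
  · rintro ⟨i, j, k, hij, hjk, hk, h1, h2, h3, rfl⟩
    have hpos := hp.convexPosition i j k hij hjk hk
    obtain ⟨x, hx⟩ := openTriangle_nonempty hpos
    exact ⟨⟨x, hp.openTriangle_subset_compl_drawing hG hij hjk hk h1 h2 h3 hx,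
      (hp.connectedComponentIn_eq hG hij hjk hk h1 h2 h3 hx).symm⟩,
      isBounded_openTriangle hpos⟩

-- The labels of a face are read off from its closure, which contains no other vertices. Two shared
-- labels amount to a shared edge, as any two corners of a face are joined by a chord and closures
-- of faces are convex.
open Classical in
theorem isTriangleGraph (hp : IsLabelling P n p) {T : SimpleGraph (vertices P)}
    (hT : IsTriangulation P T) :
    IsTriangleGraph n (chord T n p) (dualGraph T)
      (fun F => (Finset.range n).filter fun u => p u ∈ closure (F : Set Plane)) := by
  have hface : ∀ F : {F // IsBoundedFace T F}, ∃ i j k, i < j ∧ j < k ∧ k < n ∧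
      chord T n p i j ∧ chord T n p j k ∧ chord T n p i k ∧
      (F : Set Plane) = openTriangle (p i) (p j) (p k) := fun F =>
    (hp.isBoundedFace_iff hT F).1 F.2
  have hτ : ∀ {i j k : ℕ}, i < j → j < k → k < n →
      ((Finset.range n).filter fun u => p u ∈ closure (openTriangle (p i) (p j) (p k))) =
        {i, j, k} := by
    intro i j k hij hjk hk
    rw [closure_openTriangle (hp.convexPosition i j k hij hjk hk)]
    ext u
    simp only [Finset.mem_filter, Finset.mem_range, Finset.mem_insert, Finset.mem_singleton]
    constructor
    · rintro ⟨hu, h⟩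
      exact (hp.convexPosition.mem_closedTriangle_iff hij hjk hk hu).1 h
    · intro h
      have hu : u < n := by omega
      exact ⟨hu, (hp.convexPosition.mem_closedTriangle_iff hij hjk hk hu).2 h⟩
  refine ⟨fun F F' h => ?_, fun F => ?_, fun i j k hij hjk hk h1 h2 h3 => ?_, fun F F' => ?_⟩
  · obtain ⟨i, j, k, hij, hjk, hk, -, -, -, e⟩ := hface F
    obtain ⟨i', j', k', hij', hjk', hk', -, -, -, e'⟩ := hface F'
    apply Subtype.ext
    rw [e, e'] at h ⊢
    rw [hτ hij hjk hk, hτ hij' hjk' hk'] at h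
    have m1 : i ∈ ({i', j', k'} : Finset ℕ) := h ▸ by simp
    have m2 : j ∈ ({i', j', k'} : Finset ℕ) := h ▸ by simp
    have m3 : k ∈ ({i', j', k'} : Finset ℕ) := h ▸ by simp
    simp only [Finset.mem_insert, Finset.mem_singleton] at m1 m2 m3
    obtain ⟨rfl, rfl, rfl⟩ : i = i' ∧ j = j' ∧ k = k' := by omega
    rfl
  · obtain ⟨i, j, k, hij, hjk, hk, h1, h2, h3, e⟩ := hface F
    refine ⟨i, j, k, hij, hjk, hk, h1, h2, h3, ?_⟩
    rw [e, hτ hij hjk hk]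
  · exact ⟨⟨_, (hp.isBoundedFace_iff hT _).2 ⟨i, j, k, hij, hjk, hk, h1, h2, h3, rfl⟩⟩,
      hτ hij hjk hk⟩
  · simp only [Finset.mem_filter, Finset.mem_range]
    refine and_congr_right fun _ => ⟨?_, ?_⟩
    · rintro ⟨u, v, huv, hF, hF'⟩
      obtain ⟨i, j, hij, hc, h | h⟩ := hp.exists_chord_lt huv <;> rw [h.1, h.2] at hF hF'
      · exact ⟨i, j, hij, ⟨hc.1, hF (left_mem_segment ℝ _ _)⟩,
          ⟨hc.2.1, hF (right_mem_segment ℝ _ _)⟩, ⟨hc.1, hF' (left_mem_segment ℝ _ _)⟩,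
          ⟨hc.2.1, hF' (right_mem_segment ℝ _ _)⟩⟩
      · exact ⟨i, j, hij, ⟨hc.1, hF (right_mem_segment ℝ _ _)⟩,
          ⟨hc.2.1, hF (left_mem_segment ℝ _ _)⟩, ⟨hc.1, hF' (right_mem_segment ℝ _ _)⟩,
          ⟨hc.2.1, hF' (left_mem_segment ℝ _ _)⟩⟩
    · rintro ⟨u, v, huv, ⟨hu, hu1⟩, ⟨hv, hv1⟩, ⟨-, hu2⟩, ⟨-, hv2⟩⟩
      have hconv : ∀ F : {F // IsBoundedFace T F}, Convex ℝ (closure (F : Set Plane)) := by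
        intro F
        obtain ⟨i, j, k, -, -, -, -, -, -, e⟩ := hface F
        rw [e]
        exact (convex_openTriangle _ _ _).closure
      obtain ⟨i, j, k, hij, hjk, hk, h1, h2, h3, e⟩ := hface F
      have mu : u ∈ ({i, j, k} : Finset ℕ) := by
        rw [← hτ hij hjk hk, ← e]; simp [hu, hu1]
      have mv : v ∈ ({i, j, k} : Finset ℕ) := by
        rw [← hτ hij hjk hk, ← e]; simp [hv, hv1]
      simp only [Finset.mem_insert, Finset.mem_singleton] at mu mv
      have huv' : chord T n p u v := by
        rcases mu with rfl | rfl | rfl <;> rcases mv with rfl | rfl | rfl <;>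
          first | assumption | omega
      obtain ⟨-, -, hu', hv', hadj⟩ := huv'
      exact ⟨_, _, hadj, (hconv F).segment_subset hu1 hv1, (hconv F').segment_subset hu2 hv2⟩

/-! ### The dual diameter of a minDT -/

theorem dualDiameter_eq (hp : IsLabelling P n p) {T : SimpleGraph (vertices P)}
    (hT : IsTriangulation P T) {t : BinTree} (ht : t.leaves + 1 = n)
    (h : ∀ x y, t.edges 0 x y → chord T n p x y) : dualDiameter T = t.diam := by
  classical
  exact (hp.isTriangleGraph hT).ediam_eq (hp.nonCrossing hT) t ht hp.three_le h

/-- The hypotheses say that D is least with n ≤ `capacity D`. The tree has n - 1 leaves, so this is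
the least D for which n - 1 < `capacity D`. -/
theorem dualDiameter_eq_of_isMinDT (hp : IsLabelling P n p) {T : SimpleGraph (vertices P)}
    (hT : IsMinDT P T) {D : ℕ} (h : n ≤ BinTree.capacity D)
    (h' : ∀ D' < D, BinTree.capacity D' < n) : dualDiameter T = D := by
  have hn := hp.three_le
  obtain ⟨t, t1, t2⟩ := hp.exists_tree hT.1
  rw [hp.dualDiameter_eq hT.1 t1 t2]
  refine le_antisymm ?_ ?_
  · obtain ⟨s, s1, s2⟩ := BinTree.exists_leaves_eq_diam_le (D := D) (L := n - 1) (by omega)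
      (by omega)
    have s3 : s.leaves + 1 = n := by omega
    obtain ⟨S, hS, hS'⟩ := hp.exists_isTriangulation s s3
    have := hT.2 S hS
    rw [hp.dualDiameter_eq hT.1 t1 t2, hp.dualDiameter_eq hS s3 hS'] at this
    exact this.trans (by exact_mod_cast s2)
  · by_contra! hlt
    have h1 := h' t.diam (by exact_mod_cast hlt)
    have h2 := t.leaves_lt_capacity le_rfl
    omega

end IsLabelling

theorem ceil_logb_eq {n m : ℕ} (h1 : 3 * 2 ^ m < n) (h2 : n ≤ 3 * 2 ^ (m + 1)) :
    ⌈Real.logb 2 ((n : ℝ) / 3)⌉ = (m : ℤ) + 1 := by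
  have hpos : (0 : ℝ) < n / 3 := by
    have : 0 < n := by omega
    positivity
  have h1' : (3 : ℝ) * 2 ^ m < n := by exact_mod_cast h1
  have h2' : (n : ℝ) ≤ 3 * 2 ^ (m + 1) := by exact_mod_cast h2
  rw [Int.ceil_eq_iff]
  constructor
  · rw [Real.lt_logb_iff_rpow_lt (by norm_num) hpos]
    push_cast
    rw [add_sub_cancel_right, Real.rpow_natCast]
    linarith
  · rw [Real.logb_le_iff_le_rpow (by norm_num) hpos]
    push_cast
    rw [← Nat.cast_add_one, Real.rpow_natCast]
    linarith

end DualDiameter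

theorem proposition1 (P : Set DualDiameter.Plane) (hP : DualDiameter.IsConvexPolygon P)
    (n : ℕ) (hn : 3 ≤ n) (hV : (DualDiameter.vertices P).ncard = n)
    (m : ℕ) (hm : 1 ≤ m) (hnm : n ∈ Set.Icc (3 * 2 ^ (m - 1) + 1) (3 * 2 ^ m))
    (T : SimpleGraph (DualDiameter.vertices P)) (hT : DualDiameter.IsMinDT P T) :
    (n ∈ Set.Icc (3 * 2 ^ (m - 1) + 1) (4 * 2 ^ (m - 1)) →
      ∃ d : ℕ, DualDiameter.dualDiameter T = d ∧
        (d : ℤ) = 2 * ⌈Real.logb 2 ((n : ℝ) / 3)⌉ - 1) ∧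
    (n ∈ Set.Icc (4 * 2 ^ (m - 1) + 1) (3 * 2 ^ m) →
      ∃ d : ℕ, DualDiameter.dualDiameter T = d ∧
        (d : ℤ) = 2 * ⌈Real.logb 2 ((n : ℝ) / 3)⌉) := by
  obtain ⟨p, hp⟩ := hP.exists_isLabelling hn hV
  obtain ⟨k, rfl⟩ : ∃ k, m = k + 1 := ⟨m - 1, by omega⟩
  rw [Nat.add_sub_cancel]
  rw [Nat.add_sub_cancel, Set.mem_Icc] at hnm
  have hceil := DualDiameter.ceil_logb_eq (by omega) hnm.2
  -- With m = k + 1, the three consecutive capacities are the breakpoints of the two ranges of n;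
  -- smaller D are covered by monotonicity.
  have c0 : BinTree.capacity (2 * k) = 3 * 2 ^ k := by
    simp only [BinTree.capacity, show 2 * k / 2 = k by omega, show 2 * k - k = k by omega]
    ring
  have c1 : BinTree.capacity (2 * k + 1) = 4 * 2 ^ k := by
    simp only [BinTree.capacity, show (2 * k + 1) / 2 = k by omega,
      show 2 * k + 1 - k = k + 1 by omega]
    ring
  have c2 : BinTree.capacity (2 * k + 2) = 3 * 2 ^ (k + 1) := by
    simp only [BinTree.capacity, show (2 * k + 2) / 2 = k + 1 by omega,
      show 2 * k + 2 - (k + 1) = k + 1 by omega]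
    ring
  rw [hceil]
  refine ⟨fun h => ⟨2 * k + 1, ?_, by push_cast; ring⟩,
    fun h => ⟨2 * k + 2, ?_, by push_cast; ring⟩⟩
  · rw [Set.mem_Icc] at h
    refine hp.dualDiameter_eq_of_isMinDT hT (by omega) fun D hD => ?_
    have := BinTree.capacity_mono (show D ≤ 2 * k by omega)
    omega
  · rw [Set.mem_Icc] at h
    refine hp.dualDiameter_eq_of_isMinDT hT (by omega) fun D hD => ?_
    have := BinTree.capacity_mono (show D ≤ 2 * k + 1 by omega)
    omega
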